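/- Let $m\ge 1$ be an integer, $c>-1$ real, $\lambda=1/m$, and for $N\ge1$ let $Q(\zeta)=Q_N(\zeta)=|\zeta|^{2/m}-\frac{2c}{N}\log|\zeta|$. With $dA=\frac1\pi d^2\zeta$ put $$\langle h|g\rangle_N=\int_{\mathbb C}(\bar\zeta-\zeta)e^{-NQ(\zeta)}\big(h(\zeta)\overline{g(\zeta)}-\overline{h(\zeta)}g(\zeta)\big)\,dA(\zeta).$$ Real polynomials $q_k$ with $\deg q_k=k$ ($k\ge0$) are called skew-orthogonal if $\langle q_{2k+1}|q_{2l}\rangle_N=-\langle q_{2l}|q_{2k+1}\rangle_N=s_k\delta_{kl}$ with $s_k>0$, and $\langle q_{2k+1}|q_{2l+1}\rangle_N=\langle q_{2k}|q_{2l}\rangle_N=0$. With $r_N=(\lambda N/2)^{-1/(2\lambda)}$ define the pre-kernel rescaled at the origin $$\kappa_N(z,w)=r_N^3\sum_{k=0}^{N-1}\frac{q_{2k+1}(r_Nz)q_{2k}(r_Nw)-q_{2k}(r_Nz)q_{2k+1}(r_Nw)}{s_k}.$$ Define $$E_{a,b}(z)=\sum_{k\ge0}\frac{z^k}{\Gamma(ak+b)},\qquad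 E_{\alpha,\mu,l}(z)=1+\sum_{k\ge1}z^k\prod_{j=0}^{k-1}\frac{\Gamma(\alpha(j\mu+l)+1)}{\Gamma(\alpha(j\mu+l+1)+1)},$$ $$F_{m,c}(z)=z^{m(1+c)-1}E_{2m,m(1+c)}(z^{2m}),\qquad g_{j,m}(z)=z^{j-1}E_{m,2,1+\frac{j-1}{m}}(z^{2m})\quad(1\le j\le m),$$ let $W_{j,m}$ be the Wronskian of $g_{1,m},\dots,g_{m,m}$ with $g_{j,m}$ omitted, and $G(m+1)=\prod_{j=1}^{m-1}j!$. Set, for $m=1$, $$\widetilde\kappa_{1,c}(z,w)=\int_0^1\big(ze^{\frac12(1-s^2)z^2}-we^{\frac12(1-s^2)w^2}\big)F_{1,c}(szw)\,ds,$$ and for $m>1$ $$\widetilde\kappa_{\lambda,c}(z,w)=\sum_{j=1}^m\frac{(-1)^{m-j}}{G(m+1)}\int_0^1\big(zg_{j,m}(z)W_{j,m}(sz)-wg_{j,m}(w)W_{j,m}(sw)\big)F_{m,c}(szw)\,ds,$$ $$\kappa_{\lambda,c}(z,w)=\Big(\frac2\lambda\Big)^{\frac1{2\lambda}}(zw)^{\lambda-1}\,\widetilde\kappa_{\lambda,c}\Big(\sqrt{\tfrac2\lambda}\,z^\lambda,\sqrt{\tfrac2\lambda}\,w^\lambda\Big).$$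 Multivalued expressions are read as follows: for $z=e^Z$, $w=e^W$ with arbitrary $Z,W\in\mathbb C$, put $z^a=e^{aZ}$, $(zw)^a=e^{a(Z+W)}$, let $\sqrt{2/\lambda}\,z^\lambda$ carry the logarithm $\log\sqrt{2/\lambda}+\lambda Z$, let $szw$ carry the sum of the logarithms of $s$, $z$, $w$, and let $\bar z$ carry the logarithm $\overline Z$. **Theorem.** Skew-orthogonal polynomials exist for every $N\ge1$, the integrals above converge absolutely for all $z,w\ne0$, and for every choice of skew-orthogonal polynomials (one family for each $N$) the following hold. (i) $\kappa_{\lambda,c}$ is the limiting origin pre-kernel: with $h(z)=(z/|z|)^c=e^{ic\,\mathrm{Im}\,Z}$ and the cocycle $c_N(z,w)=h(z)h(w)$, as $N\to\infty$, $$e^{-\frac N2(Q(r_Nz)+Q(r_Nw))}\begin{pmatrix}(c_N\kappa_N)(z,w)&(c_N\kappa_N)(z,\bar w)\\(c_N\kappa_N)(\bar z,w)&(c_N\kappa_N)(\bar z,\bar w)\end{pmatrix}\to e^{-\frac{|z|^{2\lambda}+|w|^{2\lambda}}{\lambda}}\begin{pmatrix}\kappa_{\lambda,c}(z,w)&\kappa_{\lambda,c}(z,\bar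 w)\\\kappa_{\lambda,c}(\bar z,w)&\kappa_{\lambda,c}(\bar z,\bar w)\end{pmatrix}$$ uniformly for $(Z,W)$ in compact subsets of $\mathbb C^2$. (ii) $r_N^{2c}\kappa_N(z,w)$ converges, uniformly on compact subsets of $\mathbb C^2$, to an entire function $P(z,w)$, and $\kappa_{\lambda,c}(z,w)=(zw)^cP(z,w)$ for all $z,w\neq0$. -/

import Mathlib

open Filter Topology MeasureTheory
open scoped ComplexConjugate

noncomputable section

namespace MittagLefflerKernel

/-! ### The ensemble, its skew-orthogonal polynomials and its pre-kernel at finite `N` -/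

/-- The potential `Q(ζ) = |ζ|^{2λ} - (2c/N) log |ζ|`. -/
def potential (lam c : ℝ) (N : ℕ) (ζ : ℂ) : ℝ :=
  ‖ζ‖ ^ (2 * lam) - (2 * c / (N : ℝ)) * Real.log ‖ζ‖

/-- The anti-symmetric scalar product
`⟨h|g⟩ = ∫_ℂ (ζ̄ - ζ) e^{-N Q(ζ)} (h(ζ) conj(g(ζ)) - conj(h(ζ)) g(ζ)) dA(ζ)`,
where `dA` is the Lebesgue measure divided by `π`. -/
def skewProduct (N : ℕ) (Q : ℂ → ℝ) (h g : ℂ → ℂ) : ℂ :=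
  (1 / (Real.pi : ℂ)) *
    ∫ ζ : ℂ, (conj ζ - ζ) * (Real.exp (-(N : ℝ) * Q ζ) : ℂ) *
      (h ζ * conj (g ζ) - conj (h ζ) * g ζ)

/-- A real polynomial as a function on `ℂ`. -/
def polyFun (p : Polynomial ℝ) (ζ : ℂ) : ℂ := Polynomial.aeval ζ p

/-- `q 0, q 1, …` are skew-orthogonal polynomials (`q k` of degree `k`, with real coefficients)
associated with `Q`, with the positive skew-norms `s 0, s 1, …`. -/
structure IsSkewOrthogonal (N : ℕ) (Q : ℂ → ℝ) (q : ℕ → Polynomial ℝ) (s : ℕ → ℝ) : Prop where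
  degree_eq : ∀ k, (q k).degree = (k : WithBot ℕ)
  norm_pos : ∀ k, 0 < s k
  odd_even : ∀ k l, skewProduct N Q (polyFun (q (2 * k + 1))) (polyFun (q (2 * l))) =
    if k = l then (s k : ℂ) else 0
  even_odd : ∀ k l, skewProduct N Q (polyFun (q (2 * l))) (polyFun (q (2 * k + 1))) =
    if k = l then -(s k : ℂ) else 0
  odd_odd : ∀ k l, skewProduct N Q (polyFun (q (2 * k + 1))) (polyFun (q (2 * l + 1))) = 0
  even_even : ∀ k l, skewProduct N Q (polyFun (q (2 * k))) (polyFun (q (2 * l))) = 0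

/-- The pre-kernel `∑_{k<N} (q_{2k+1}(ζ) q_{2k}(η) - q_{2k}(ζ) q_{2k+1}(η)) / s_k`
before rescaling. -/
def preKernel (N : ℕ) (q : ℕ → Polynomial ℝ) (s : ℕ → ℝ) (ζ η : ℂ) : ℂ :=
  ∑ k ∈ Finset.range N,
    (polyFun (q (2 * k + 1)) ζ * polyFun (q (2 * k)) η -
      polyFun (q (2 * k)) ζ * polyFun (q (2 * k + 1)) η) / (s k : ℂ)

/-- The micro-scale at the origin, `r_N = (λ N / 2)^{-1/(2λ)}`. -/
def microScale (lam : ℝ) (N : ℕ) : ℝ := (lam / 2 * (N : ℝ)) ^ (-(1 / (2 * lam)))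

/-- The pre-kernel `κ_N(z, w)` rescaled at the origin. -/
def rescaledPreKernel (lam : ℝ) (N : ℕ) (q : ℕ → Polynomial ℝ) (s : ℕ → ℝ) (z w : ℂ) : ℂ :=
  (microScale lam N : ℂ) ^ 3 *
    preKernel N q s ((microScale lam N : ℂ) * z) ((microScale lam N : ℂ) * w)

/-! ### Kernels in logarithmic coordinates

Non-integer powers of `z` are multivalued.  Points `z, w ≠ 0` are therefore written as
`z = exp Z`, `w = exp W`, where `Z, W : ℂ` are arbitrary choices of their logarithms, and
`z ^ a = exp (a Z)`, `(z w) ^ a = exp (a (Z + W))`; the conjugate `z̄` carries the logarithm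
`conj Z`.  Taking `Z = Complex.log z` on the slit plane gives the principal branches. -/

/-- The unimodular function `h(z) = (z/|z|)^c`, `z = exp Z`. -/
def unimodular (c : ℝ) (Z : ℂ) : ℂ := Complex.exp (Complex.I * (c : ℂ) * (Z.im : ℂ))

/-- The `2 × 2` matrix formed from a pre-kernel: `(κ(z,w), κ(z,w̄); κ(z̄,w), κ(z̄,w̄))`. -/
def kernelMatrix (κ : ℂ → ℂ → ℂ) (Z W : ℂ) : Matrix (Fin 2) (Fin 2) ℂ :=
  !![κ Z W, κ Z (conj W); κ (conj Z) W, κ (conj Z) (conj W)]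

/-- The kernel `c_N · K_N` of the rescaled process at `z = exp Z`, `w = exp W`, where `c_N` is the
cocycle `h(z) h(w)`:
`e^{-(N/2)(Q(r_N z) + Q(r_N w))}` times the matrix of the pre-kernel `c_N(z,w) κ_N(z,w)`. -/
def finiteKernel (lam c : ℝ) (N : ℕ) (q : ℕ → Polynomial ℝ) (s : ℕ → ℝ) (Z W : ℂ) :
    Matrix (Fin 2) (Fin 2) ℂ :=
  (Real.exp (-((N : ℝ) / 2) *
      (potential lam c N ((microScale lam N : ℂ) * Complex.exp Z) +
        potential lam c N ((microScale lam N : ℂ) * Complex.exp W))) : ℂ) •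
    kernelMatrix
      (fun U V => unimodular c U * unimodular c V *
        rescaledPreKernel lam N q s (Complex.exp U) (Complex.exp V)) Z W

/-- `e^{-(|z|^{2λ} + |w|^{2λ})/λ}` times the matrix of the pre-kernel `κ`, at `z = exp Z`,
`w = exp W`. -/
def limitKernel (lam : ℝ) (κ : ℂ → ℂ → ℂ) (Z W : ℂ) : Matrix (Fin 2) (Fin 2) ℂ :=
  (Real.exp (-((‖Complex.exp Z‖ ^ (2 * lam) + ‖Complex.exp W‖ ^ (2 * lam)) / lam)) : ℂ) •
    kernelMatrix κ Z W

/-! ### The special functions -/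

/-- The two-parametric Mittag-Leffler function `E_{a,b}(z) = ∑_k z^k / Γ(a k + b)`. -/
def mittagLeffler (a b : ℝ) (z : ℂ) : ℂ :=
  ∑' k : ℕ, z ^ k / (Real.Gamma (a * k + b) : ℂ)

/-- The Kilbas–Saigo function
`E_{α,m,l}(z) = 1 + ∑_{k ≥ 1} z^k ∏_{j<k} Γ(α(jm+l)+1) / Γ(α(jm+l+1)+1)`
(the term `k = 0` of the sum below is `1`). -/
def kilbasSaigo (α m l : ℝ) (z : ℂ) : ℂ :=
  ∑' k : ℕ, z ^ k * ∏ j ∈ Finset.range k,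
    ((Real.Gamma (α * (j * m + l) + 1) / Real.Gamma (α * (j * m + l + 1) + 1) : ℝ) : ℂ)

/-- `F_{m,c}(z) = z^{m(1+c)-1} E_{2m, m(1+c)}(z^{2m})` at `z = exp ℓ`. -/
def FML (m : ℕ) (c : ℝ) (ℓ : ℂ) : ℂ :=
  Complex.exp (((m * (1 + c) - 1 : ℝ) : ℂ) * ℓ) *
    mittagLeffler (2 * m) (m * (1 + c)) (Complex.exp ℓ ^ (2 * m))

/-- `g_{j,m}(z) = z^{j-1} E_{m, 2, 1+(j-1)/m}(z^{2m})` for `1 ≤ j ≤ m`. -/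
def g (m j : ℕ) (z : ℂ) : ℂ :=
  z ^ (j - 1) * kilbasSaigo m 2 (1 + ((j : ℝ) - 1) / m) (z ^ (2 * m))

/-- The Wronskian of `n` functions, `det (f_k^{(i)}(z))_{i,k}`. -/
def wronskian {n : ℕ} (f : Fin n → ℂ → ℂ) (z : ℂ) : ℂ :=
  (Matrix.of fun i k : Fin n => iteratedDeriv (i : ℕ) (f k) z).det

/-- `W_{j,m}`, the Wronskian of `g_{1,m}, …, g_{m,m}` with `g_{j,m}` left out. -/
def Wminor (m j : ℕ) (z : ℂ) : ℂ :=
  wronskian (fun k : Fin (m - 1) => g m (if (k : ℕ) + 1 < j then (k : ℕ) + 1 else (k : ℕ) + 2)) z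

/-- `G(m+1) = ∏_{j=1}^{m-1} j!`. -/
def barnesG (m : ℕ) : ℂ := ∏ j ∈ Finset.Icc 1 (m - 1), (Nat.factorial j : ℂ)

/-! ### The explicit pre-kernel -/

/-- `(z e^{(1-s²)z²/2} - w e^{(1-s²)w²/2}) F_{1,c}(s z w)` at `z = exp Z`, `w = exp W`. -/
def integrandOne (c : ℝ) (Z W : ℂ) (s : ℝ) : ℂ :=
  (Complex.exp Z * Complex.exp (1 / 2 * (1 - (s : ℂ) ^ 2) * Complex.exp Z ^ 2) -
      Complex.exp W * Complex.exp (1 / 2 * (1 - (s : ℂ) ^ 2) * Complex.exp W ^ 2)) *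
    FML 1 c ((Real.log s : ℂ) + Z + W)

/-- `(z g_{j,m}(z) W_{j,m}(sz) - w g_{j,m}(w) W_{j,m}(sw)) F_{m,c}(s z w)` at `z = exp Z`,
`w = exp W`. -/
def integrand (m : ℕ) (c : ℝ) (j : ℕ) (Z W : ℂ) (s : ℝ) : ℂ :=
  (Complex.exp Z * g m j (Complex.exp Z) * Wminor m j ((s : ℂ) * Complex.exp Z) -
      Complex.exp W * g m j (Complex.exp W) * Wminor m j ((s : ℂ) * Complex.exp W)) *
    FML m c ((Real.log s : ℂ) + Z + W)

/-- The function `κ̃_{1/m,c}(z, w)` at `z = exp Z`, `w = exp W`. -/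
def kappaTilde (m : ℕ) (c : ℝ) (Z W : ℂ) : ℂ :=
  if m = 1 then ∫ s in (0 : ℝ)..1, integrandOne c Z W s
  else ∑ j ∈ Finset.Icc 1 m,
    (-1 : ℂ) ^ (m - j) / barnesG m * ∫ s in (0 : ℝ)..1, integrand m c j Z W s

/-- A logarithm of `√(2/λ) z^λ`, `z = exp Z`. -/
def logScale (lam : ℝ) (Z : ℂ) : ℂ := (Real.log (Real.sqrt (2 / lam)) : ℂ) + (lam : ℂ) * Z

/-- `κ_{λ,c}(z,w) = (2/λ)^{1/(2λ)} (zw)^{λ-1} κ̃_{λ,c}(√(2/λ) z^λ, √(2/λ) w^λ)` with `λ = 1/m`,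
at `z = exp Z`, `w = exp W`. -/
def kappa (m : ℕ) (c : ℝ) (Z W : ℂ) : ℂ :=
  (((2 / (1 / (m : ℝ))) ^ (1 / (2 * (1 / (m : ℝ)))) : ℝ) : ℂ) *
    Complex.exp (((1 / (m : ℝ) - 1 : ℝ) : ℂ) * (Z + W)) *
    kappaTilde m c (logScale (1 / (m : ℝ)) Z) (logScale (1 / (m : ℝ)) W)

end MittagLefflerKernel

end

/-!
The sum `∑_k (q_{2k+1}(z) q_{2k}(w) - q_{2k}(z) q_{2k+1}(w)) / s_k` is read off the inverse of the
Gram matrix of the skew product, so it does not depend on the skew-orthogonal family. For a radial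
weight there is an explicit family: the odd polynomials are monomials and the coefficients of the
even ones are products of quotients of moments. For the Mittag-Leffler potential the moments are
Gamma values, and at scale `r_N` the powers of `N` cancel: the pre-kernel is exactly a partial sum
of an `N`-independent double power series whose coefficients are products of Gamma quotients. That
series is entire, which gives both limits.

The explicit formula expands into the same series. Expand `F_{m,c}(szw)` termwise; what is left are
the moments `∫₀¹ s^a ψ(s) ds`, where `ψ(s) = z K(z, sz)` and `K` is the Cauchy function of the
equation `y^{(m)} = t^m y`, which has the fundamental system `g_{1,m}, …, g_{m,m}`; by Cramer's
rule `K` is the sum of the `g_{j,m}` against the minors `W_{j,m}` of their Wronskian matrix. In its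
second variable `K` solves the adjoint equation, so `m` integrations by parts express the `a`-th
moment through the `(a + 2m)`-th, and iterating reproduces the Gamma quotients. For `m = 1` the
Cauchy function is `e^{(z² - t²)/2}`.
-/

noncomputable section

namespace MittagLefflerKernel

section GeneralPotential

/-! ### Skew products of polynomials -/

variable {N n : ℕ} {Q : ℂ → ℝ} {p q : Polynomial ℝ}

/-- The weight `e^{-NQ}` against which the skew product integrates. -/
def weight (N : ℕ) (Q : ℂ → ℝ) (ζ : ℂ) : ℝ := Real.exp (-(N : ℝ) * Q ζ)

/-- Every polynomial in `ζ` and `ζ̄` is integrable against `e^{-NQ}`, so that the skew product of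
polynomials is not a junk value. -/
def HasPolynomialMoments (N : ℕ) (Q : ℂ → ℝ) : Prop :=
  ∀ k : ℕ, Integrable fun ζ : ℂ => ‖ζ‖ ^ k * weight N Q ζ

/-- The Gram matrix of the monomials for the skew product. -/
def gram (N : ℕ) (Q : ℂ → ℝ) (a b : ℕ) : ℂ := skewProduct N Q (fun ζ => ζ ^ a) fun ζ => ζ ^ b

theorem weight_pos (ζ : ℂ) : 0 < weight N Q ζ := Real.exp_pos _

theorem HasPolynomialMoments.integrable_weight (hQ : HasPolynomialMoments N Q) :
    Integrable (weight N Q) := by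
  simpa only [pow_zero, one_mul] using hQ 0

theorem HasPolynomialMoments.integrable_pow_mul_conj_pow (hQ : HasPolynomialMoments N Q)
    (a b : ℕ) : Integrable fun ζ : ℂ => ζ ^ a * conj ζ ^ b * (weight N Q ζ : ℂ) := by
  have hmonomial : AEStronglyMeasurable fun ζ : ℂ => ζ ^ a * conj ζ ^ b :=
    Continuous.aestronglyMeasurable (by fun_prop)
  refine (hQ (a + b)).mono' (hmonomial.mul hQ.integrable_weight.ofReal.aestronglyMeasurable)
    (ae_of_all _ fun ζ => ?_)
  simp [abs_of_pos (weight_pos ζ), pow_add]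

theorem skewProduct_monomial_integrand (a b : ℕ) (ζ : ℂ) :
    (conj ζ - ζ) * (weight N Q ζ : ℂ) * (ζ ^ a * conj (ζ ^ b) - conj (ζ ^ a) * ζ ^ b) =
      ζ ^ a * conj ζ ^ (b + 1) * (weight N Q ζ : ℂ) -
        ζ ^ b * conj ζ ^ (a + 1) * (weight N Q ζ : ℂ) -
        ζ ^ (a + 1) * conj ζ ^ b * (weight N Q ζ : ℂ) +
        ζ ^ (b + 1) * conj ζ ^ a * (weight N Q ζ : ℂ) := by
  rw [map_pow, map_pow]
  ring

theorem HasPolynomialMoments.integrable_skewProduct_monomial (hQ : HasPolynomialMoments N Q)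
    (a b : ℕ) : Integrable fun ζ : ℂ =>
      (conj ζ - ζ) * (weight N Q ζ : ℂ) * (ζ ^ a * conj (ζ ^ b) - conj (ζ ^ a) * ζ ^ b) := by
  simp_rw [skewProduct_monomial_integrand]
  have h := hQ.integrable_pow_mul_conj_pow
  exact (((h _ _).sub (h _ _)).sub (h _ _)).add (h _ _)

theorem polyFun_eq_sum_range (hp : p.natDegree < n) (ζ : ℂ) :
    polyFun p ζ = ∑ a ∈ Finset.range n, (p.coeff a : ℂ) * ζ ^ a := by
  rw [polyFun, Polynomial.aeval_eq_sum_range' hp]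
  simp only [Complex.real_smul]

theorem HasPolynomialMoments.skewProduct_polyFun (hQ : HasPolynomialMoments N Q)
    (hp : p.natDegree < n) (hq : q.natDegree < n) :
    skewProduct N Q (polyFun p) (polyFun q) = ∑ a ∈ Finset.range n, ∑ b ∈ Finset.range n,
      (p.coeff a : ℂ) * (q.coeff b : ℂ) * gram N Q a b := by
  have hbilin (ζ : ℂ) : (conj ζ - ζ) * (weight N Q ζ : ℂ) *
      (polyFun p ζ * conj (polyFun q ζ) - conj (polyFun p ζ) * polyFun q ζ) =
      ∑ a ∈ Finset.range n, ∑ b ∈ Finset.range n, (p.coeff a : ℂ) * (q.coeff b : ℂ) *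
        ((conj ζ - ζ) * (weight N Q ζ : ℂ) *
          (ζ ^ a * conj (ζ ^ b) - conj (ζ ^ a) * ζ ^ b)) := by
    rw [polyFun_eq_sum_range hp, polyFun_eq_sum_range hq]
    simp only [map_sum, map_mul, Complex.conj_ofReal]
    rw [Finset.sum_mul_sum, Finset.sum_mul_sum]
    simp only [← Finset.sum_sub_distrib, Finset.mul_sum]
    exact Finset.sum_congr rfl fun a _ => Finset.sum_congr rfl fun b _ => by ring
  have hint (a b : ℕ) := (hQ.integrable_skewProduct_monomial a b).const_mul
    ((p.coeff a : ℂ) * (q.coeff b : ℂ))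
  calc skewProduct N Q (polyFun p) (polyFun q)
      = 1 / (Real.pi : ℂ) * ∫ ζ : ℂ, ∑ a ∈ Finset.range n, ∑ b ∈ Finset.range n,
          (p.coeff a : ℂ) * (q.coeff b : ℂ) * ((conj ζ - ζ) * (weight N Q ζ : ℂ) *
            (ζ ^ a * conj (ζ ^ b) - conj (ζ ^ a) * ζ ^ b)) :=
        congrArg _ (integral_congr_ae (ae_of_all _ hbilin))
    _ = ∑ a ∈ Finset.range n, ∑ b ∈ Finset.range n,
          (p.coeff a : ℂ) * (q.coeff b : ℂ) * gram N Q a b := by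
        rw [integral_finsetSum _ fun a _ => integrable_finsetSum _ fun b _ => hint a b,
          Finset.mul_sum]
        refine Finset.sum_congr rfl fun a _ => ?_
        rw [integral_finsetSum _ fun b _ => hint a b, Finset.mul_sum]
        refine Finset.sum_congr rfl fun b _ => ?_
        rw [integral_const_mul, mul_left_comm]
        rfl

theorem skewProduct_swap (N : ℕ) (Q : ℂ → ℝ) (h g : ℂ → ℂ) :
    skewProduct N Q h g = -skewProduct N Q g h := by
  rw [skewProduct, skewProduct, ← mul_neg, ← integral_neg]
  congr 2 with ζ
  ring

/-! ### The pre-kernel does not depend on the skew-orthogonal polynomials -/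

variable {qs qs' : ℕ → Polynomial ℝ} {s s' : ℕ → ℝ}

/-- The degree `2k + e` of the basis element with index `(e, k)`; indexing by pairs makes the
skew-orthogonality relations block diagonal. -/
def pairDegree (i : Fin 2 × Fin N) : ℕ := 2 * i.2 + i.1

theorem pairDegree_lt (i : Fin 2 × Fin N) : pairDegree i < 2 * N := by
  rw [pairDegree]
  omega

theorem sum_pairDegree {M : Type*} [AddCommMonoid M] (f : ℕ → M) :
    ∑ i : Fin 2 × Fin N, f (pairDegree i) = ∑ a ∈ Finset.range (2 * N), f a := by
  simp only [Fintype.sum_prod_type_right, Fin.sum_univ_two, pairDegree, Fin.coe_ofNat_eq_mod]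
  rw [Fin.sum_univ_eq_sum_range (fun k => f (2 * k + 0 % 2) + f (2 * k + 1 % 2)) N]
  induction N with
  | zero => simp
  | succ n ih =>
    rw [Finset.sum_range_succ, ih, mul_add, Finset.sum_range_succ, Finset.sum_range_succ, add_assoc]
    rfl

/-- The matrix of the coefficients of the polynomials `q_0, …, q_{2N-1}`. -/
def coeffMatrix (N : ℕ) (qs : ℕ → Polynomial ℝ) : Matrix (Fin 2 × Fin N) (Fin 2 × Fin N) ℂ :=
  Matrix.of fun i j => (((qs (pairDegree i)).coeff (pairDegree j) : ℝ) : ℂ)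

/-- The Gram matrix of `1, ζ, …, ζ^{2N-1}`. -/
def gramMatrix (N : ℕ) (Q : ℂ → ℝ) : Matrix (Fin 2 × Fin N) (Fin 2 × Fin N) ℂ :=
  Matrix.of fun i j => gram N Q (pairDegree i) (pairDegree j)

/-- The Gram matrix of skew-orthogonal polynomials with skew-norms `s_k`. -/
def skewNormMatrix (N : ℕ) (s : ℕ → ℝ) : Matrix (Fin 2 × Fin N) (Fin 2 × Fin N) ℂ :=
  Matrix.blockDiagonal fun k : Fin N => !![0, -(s k : ℂ); (s k : ℂ), 0]

/-- The coefficients of the pre-kernel with respect to `q_0, …, q_{2N-1}`. -/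
def invSkewNormMatrix (N : ℕ) (s : ℕ → ℝ) : Matrix (Fin 2 × Fin N) (Fin 2 × Fin N) ℂ :=
  Matrix.blockDiagonal fun k : Fin N => !![0, -(1 / (s k : ℂ)); 1 / (s k : ℂ), 0]

theorem invSkewNormMatrix_mul_skewNormMatrix (hs : ∀ k, s k ≠ 0) :
    invSkewNormMatrix N s * skewNormMatrix N s = -1 := by
  rw [invSkewNormMatrix, skewNormMatrix, ← Matrix.blockDiagonal_mul, ← Matrix.blockDiagonal_one,
    ← Matrix.blockDiagonal_neg]
  congr 1
  ext k i j
  have : (s k : ℂ) ≠ 0 := Complex.ofReal_ne_zero.mpr (hs k)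
  fin_cases i <;> fin_cases j <;> simp [this]

theorem coeffMatrix_mulVec_pow (hq : ∀ k, (qs k).natDegree = k) (ζ : ℂ) :
    (coeffMatrix N qs).mulVec (fun i => ζ ^ pairDegree i) =
      fun i => polyFun (qs (pairDegree i)) ζ := by
  ext i
  rw [polyFun_eq_sum_range ((hq _).trans_lt (pairDegree_lt i)), ← sum_pairDegree]
  rfl

theorem preKernel_eq_dotProduct (hq : ∀ k, (qs k).natDegree = k) (ζ η : ℂ) :
    preKernel N qs s ζ η = (fun i : Fin 2 × Fin N => ζ ^ pairDegree i) ⬝ᵥ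
      (((coeffMatrix N qs).transpose * invSkewNormMatrix N s * coeffMatrix N qs).mulVec
        fun i => η ^ pairDegree i) := by
  rw [← Matrix.mulVec_mulVec, ← Matrix.mulVec_mulVec, Matrix.dotProduct_mulVec,
    Matrix.vecMul_transpose, coeffMatrix_mulVec_pow hq, coeffMatrix_mulVec_pow hq, preKernel,
    ← Fin.sum_univ_eq_sum_range (fun k =>
      (polyFun (qs (2 * k + 1)) ζ * polyFun (qs (2 * k)) η -
        polyFun (qs (2 * k)) ζ * polyFun (qs (2 * k + 1)) η) / (s k : ℂ))]
  simp only [dotProduct, Matrix.mulVec, invSkewNormMatrix, Fintype.sum_prod_type_right,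
    Fin.sum_univ_two, Matrix.blockDiagonal_apply]
  refine Finset.sum_congr rfl fun k _ => ?_
  simp only [pairDegree, Fin.isValue, Fin.coe_ofNat_eq_mod, Nat.zero_mod, add_zero, one_div,
    Matrix.of_apply, Matrix.cons_val', Matrix.cons_val_zero, Matrix.cons_val_fin_one, ite_self,
    zero_mul, Matrix.cons_val_one, Nat.mod_succ, ite_mul, neg_mul, zero_add, Finset.sum_ite_eq,
    Finset.mem_univ, ↓reduceIte, mul_neg]
  ring

theorem HasPolynomialMoments.coeffMatrix_mul_gramMatrix (hQ : HasPolynomialMoments N Q)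
    (hq : ∀ k, (qs k).natDegree = k) (i j : Fin 2 × Fin N) :
    (coeffMatrix N qs * gramMatrix N Q * (coeffMatrix N qs).transpose) i j =
      skewProduct N Q (polyFun (qs (pairDegree i))) (polyFun (qs (pairDegree j))) := by
  rw [hQ.skewProduct_polyFun ((hq _).trans_lt (pairDegree_lt i))
    ((hq _).trans_lt (pairDegree_lt j)), Finset.sum_comm, ← sum_pairDegree]
  simp only [Matrix.mul_apply, Matrix.transpose_apply, Finset.sum_mul]
  refine Finset.sum_congr rfl fun b _ => ?_
  rw [← sum_pairDegree]
  exact Finset.sum_congr rfl fun a _ => mul_right_comm _ _ _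

namespace IsSkewOrthogonal

theorem natDegree_eq (h : IsSkewOrthogonal N Q qs s) (k : ℕ) : (qs k).natDegree = k :=
  Polynomial.natDegree_eq_of_degree_eq_some (h.degree_eq k)

theorem skewProduct_pairDegree (h : IsSkewOrthogonal N Q qs s) (i j : Fin 2 × Fin N) :
    skewProduct N Q (polyFun (qs (pairDegree i))) (polyFun (qs (pairDegree j))) =
      skewNormMatrix N s i j := by
  obtain ⟨u, k⟩ := i
  obtain ⟨v, l⟩ := j
  rw [skewNormMatrix, Matrix.blockDiagonal_apply]
  simp only [pairDegree]
  fin_cases u <;> fin_cases v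
  · exact (h.even_even k l).trans (by simp)
  · rcases eq_or_ne k l with rfl | hkl
    · exact (h.even_odd k k).trans (by simp)
    · exact (h.even_odd l k).trans (by simp [Fin.val_inj, hkl, hkl.symm])
  · exact (h.odd_even k l).trans (by simp [Fin.val_inj])
  · exact (h.odd_odd k l).trans (by simp)

theorem congr_gramMatrix (h : IsSkewOrthogonal N Q qs s) (hQ : HasPolynomialMoments N Q) :
    coeffMatrix N qs * gramMatrix N Q * (coeffMatrix N qs).transpose = skewNormMatrix N s := by
  ext i j
  rw [hQ.coeffMatrix_mul_gramMatrix h.natDegree_eq, h.skewProduct_pairDegree]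

theorem neg_mul_gramMatrix (h : IsSkewOrthogonal N Q qs s) (hQ : HasPolynomialMoments N Q) :
    (-((coeffMatrix N qs).transpose * invSkewNormMatrix N s * coeffMatrix N qs)) *
      gramMatrix N Q = 1 := by
  have hinv := invSkewNormMatrix_mul_skewNormMatrix (N := N) fun k => (h.norm_pos k).ne'
  have hleft : -(invSkewNormMatrix N s * coeffMatrix N qs * gramMatrix N Q) *
      (coeffMatrix N qs).transpose = 1 := by
    rw [Matrix.neg_mul, Matrix.mul_assoc, Matrix.mul_assoc, ← Matrix.mul_assoc (coeffMatrix N qs),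
      h.congr_gramMatrix hQ, hinv, neg_neg]
  rw [← mul_eq_one_comm.mp hleft]
  simp only [Matrix.neg_mul, Matrix.mul_neg, Matrix.mul_assoc]

theorem preKernel_eq (h : IsSkewOrthogonal N Q qs s) (h' : IsSkewOrthogonal N Q qs' s')
    (hQ : HasPolynomialMoments N Q) (ζ η : ℂ) :
    preKernel N qs s ζ η = preKernel N qs' s' ζ η := by
  rw [preKernel_eq_dotProduct h.natDegree_eq, preKernel_eq_dotProduct h'.natDegree_eq,
    neg_inj.mp (left_inv_eq_right_inv (h.neg_mul_gramMatrix hQ)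
      (mul_eq_one_comm.mp (h'.neg_mul_gramMatrix hQ)))]

end IsSkewOrthogonal

end GeneralPotential

section RadialPotential

/-! ### Skew-orthogonal polynomials of a radial potential -/

open Finset.HasAntidiagonal (antidiagonal mem_antidiagonal)

variable {N : ℕ} {Q : ℂ → ℝ} {p q : Polynomial ℝ}

/-- Potentials that depend on `|ζ|` only. -/
def IsRadial (Q : ℂ → ℝ) : Prop := ∀ ζ η : ℂ, ‖ζ‖ = ‖η‖ → Q ζ = Q η

/-- The moment `h_k = ∫ |ζ|^{2k} e^{-NQ(ζ)} dA(ζ)`. -/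
def moment (N : ℕ) (Q : ℂ → ℝ) (k : ℕ) : ℝ :=
  Real.pi⁻¹ * ∫ ζ : ℂ, ‖ζ‖ ^ (2 * k) * weight N Q ζ

theorem HasPolynomialMoments.moment_pos (hQ : HasPolynomialMoments N Q) (k : ℕ) :
    0 < moment N Q k := by
  have hsupport : Function.support (fun ζ : ℂ => ‖ζ‖ ^ (2 * k) * weight N Q ζ) ⊇ {0}ᶜ :=
    fun ζ hζ => mul_ne_zero (pow_ne_zero _ (norm_ne_zero_iff.mpr hζ)) (weight_pos ζ).ne'
  refine mul_pos (inv_pos.mpr Real.pi_pos) ((integral_pos_iff_support_of_nonneg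
    (fun ζ => mul_nonneg (by positivity) (weight_pos ζ).le) (hQ _)).mpr ?_)
  refine lt_of_lt_of_le ?_ (measure_mono hsupport)
  exact isOpen_compl_singleton.measure_pos volume ⟨1, one_ne_zero⟩

theorem integral_pow_mul_conj_pow_self (k : ℕ) :
    ∫ ζ : ℂ, ζ ^ k * conj ζ ^ k * (weight N Q ζ : ℂ) = (Real.pi * moment N Q k : ℝ) := by
  rw [moment, mul_inv_cancel_left₀ Real.pi_ne_zero, ← integral_complex_ofReal]
  congr 1 with ζ
  rw [← mul_pow, Complex.mul_conj, Complex.normSq_eq_norm_sq]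
  push_cast
  ring

theorem exists_circle_pow_mul_conj_pow {a b : ℕ} (hab : a ≠ b) :
    ∃ u : Circle, (u : ℂ) ^ a * conj (u : ℂ) ^ b = -1 := by
  have hne : (a : ℂ) - b ≠ 0 := sub_ne_zero.mpr (by exact_mod_cast hab)
  refine ⟨Circle.exp (Real.pi / ((a : ℝ) - b)), ?_⟩
  rw [Circle.coe_exp, ← Complex.exp_conj, ← Complex.exp_nat_mul, ← Complex.exp_nat_mul,
    ← Complex.exp_add, ← Complex.exp_pi_mul_I]
  congr 1
  simp only [map_mul, Complex.conj_ofReal, Complex.conj_I]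
  push_cast
  field_simp
  ring

theorem IsRadial.integral_pow_mul_conj_pow (hr : IsRadial Q) {a b : ℕ} (hab : a ≠ b) :
    ∫ ζ : ℂ, ζ ^ a * conj ζ ^ b * (weight N Q ζ : ℂ) = 0 := by
  obtain ⟨u, hu⟩ := exists_circle_pow_mul_conj_pow hab
  have hrotate (ζ : ℂ) : rotation u ζ ^ a * conj (rotation u ζ) ^ b *
      (weight N Q (rotation u ζ) : ℂ) = -(ζ ^ a * conj ζ ^ b * (weight N Q ζ : ℂ)) := by
    have hweight : weight N Q (rotation u ζ) = weight N Q ζ := by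
      rw [weight, weight, hr _ _ ((rotation u).norm_map ζ)]
    rw [hweight, rotation_apply, map_mul, mul_pow, mul_pow]
    linear_combination (ζ ^ a * conj ζ ^ b * (weight N Q ζ : ℂ)) * hu
  have hinvariant := (rotation u).measurePreserving.integral_comp
    (rotation u).toHomeomorph.measurableEmbedding
    fun ζ : ℂ => ζ ^ a * conj ζ ^ b * (weight N Q ζ : ℂ)
  simp_rw [hrotate, integral_neg] at hinvariant
  exact self_eq_neg.mp hinvariant.symm

theorem IsRadial.integral_pow_mul_conj_pow_eq_ite (hr : IsRadial Q) (a b : ℕ) :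
    ∫ ζ : ℂ, ζ ^ a * conj ζ ^ b * (weight N Q ζ : ℂ) =
      if a = b then ((Real.pi * moment N Q a : ℝ) : ℂ) else 0 := by
  split_ifs with hab
  · rw [← hab, integral_pow_mul_conj_pow_self]
  · exact hr.integral_pow_mul_conj_pow hab

theorem IsRadial.gram_eq (hr : IsRadial Q) (hQ : HasPolynomialMoments N Q) (a b : ℕ) :
    gram N Q a b = (if a = b + 1 then 2 * (moment N Q a : ℂ) else 0) -
      if b = a + 1 then 2 * (moment N Q b : ℂ) else 0 := by
  have hint := hQ.integrable_pow_mul_conj_pow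
  have hexpand : ∫ ζ : ℂ, (conj ζ - ζ) * (weight N Q ζ : ℂ) *
      (ζ ^ a * conj (ζ ^ b) - conj (ζ ^ a) * ζ ^ b) =
      (if a = b + 1 then ((Real.pi * moment N Q a : ℝ) : ℂ) else 0) -
        (if b = a + 1 then ((Real.pi * moment N Q b : ℝ) : ℂ) else 0) -
        (if a + 1 = b then ((Real.pi * moment N Q (a + 1) : ℝ) : ℂ) else 0) +
        if b + 1 = a then ((Real.pi * moment N Q (b + 1) : ℝ) : ℂ) else 0 := by
    simp_rw [skewProduct_monomial_integrand, ← hr.integral_pow_mul_conj_pow_eq_ite]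
    have h₁ := (hint a (b + 1)).sub (hint b (a + 1))
    have h₂ := h₁.sub (hint (a + 1) b)
    exact (integral_add h₂ (hint (b + 1) a)).trans (congrArg (· + _)
      ((integral_sub h₁ (hint _ _)).trans (congrArg (· - _) (integral_sub (hint _ _) (hint _ _)))))
  have hπ : (Real.pi : ℂ) ≠ 0 := Complex.ofReal_ne_zero.mpr Real.pi_ne_zero
  calc gram N Q a b = 1 / (Real.pi : ℂ) * ∫ ζ : ℂ, (conj ζ - ζ) * (weight N Q ζ : ℂ) *
      (ζ ^ a * conj (ζ ^ b) - conj (ζ ^ a) * ζ ^ b) := rfl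
    _ = _ := by
      rw [hexpand]
      rcases eq_or_ne a (b + 1) with rfl | hab
      · simp only [one_div, ↓reduceIte, Complex.ofReal_mul, sub_zero,
          show b ≠ b + 1 + 1 by omega, show b + 1 + 1 ≠ b by omega]
        field_simp
        ring
      · rcases eq_or_ne b (a + 1) with rfl | hba
        · simp only [one_div, ↓reduceIte, Complex.ofReal_mul, zero_sub,
            add_zero, show a ≠ a + 1 + 1 by omega, show a + 1 + 1 ≠ a by omega]
          field_simp
          ring
        · simp [hab, hba, hab.symm, hba.symm]

theorem IsRadial.skewProduct_X_pow_succ (hr : IsRadial Q) (hQ : HasPolynomialMoments N Q)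
    (a : ℕ) (p : Polynomial ℝ) :
    skewProduct N Q (polyFun (Polynomial.X ^ (a + 1))) (polyFun p) =
      ((2 * moment N Q (a + 1) * p.coeff a -
        2 * moment N Q (a + 2) * p.coeff (a + 2) : ℝ) : ℂ) := by
  rw [hQ.skewProduct_polyFun (n := a + p.natDegree + 3)
      (by rw [Polynomial.natDegree_X_pow]; omega) (by omega),
    Finset.sum_eq_single (a + 1) (fun b _ hb => by simp [Polynomial.coeff_X_pow, hb])
      (fun h => absurd (Finset.mem_range.mpr (by omega)) h)]
  simp only [hr.gram_eq hQ, Polynomial.coeff_X_pow_self, Complex.ofReal_one, one_mul, mul_sub,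
    mul_ite, mul_zero, Finset.sum_sub_distrib, Nat.add_right_cancel_iff, Finset.sum_ite_eq,
    Finset.sum_ite_eq', Finset.mem_range]
  rw [if_pos (by omega), if_pos (by omega)]
  push_cast
  ring

theorem IsRadial.skewProduct_eq_zero_of_even (hr : IsRadial Q) (hQ : HasPolynomialMoments N Q)
    (hp : ∀ a, p.coeff (2 * a + 1) = 0) (hq : ∀ a, q.coeff (2 * a + 1) = 0) :
    skewProduct N Q (polyFun p) (polyFun q) = 0 := by
  rw [hQ.skewProduct_polyFun (n := p.natDegree + q.natDegree + 1) (by omega) (by omega)]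
  refine Finset.sum_eq_zero fun a _ => Finset.sum_eq_zero fun b _ => ?_
  obtain ⟨k, rfl | rfl⟩ := Nat.even_or_odd' a
  · obtain ⟨l, rfl | rfl⟩ := Nat.even_or_odd' b
    · rw [hr.gram_eq hQ, if_neg (by omega), if_neg (by omega), sub_self, mul_zero]
    · rw [hq, Complex.ofReal_zero, mul_zero, zero_mul]
  · rw [hp, Complex.ofReal_zero, zero_mul, zero_mul]

/-- The coefficient of `ζ^{2l}` in the skew-orthogonal polynomial of degree `2k`. -/
def evenCoeff (N : ℕ) (Q : ℂ → ℝ) (k l : ℕ) : ℝ :=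
  ∏ i ∈ Finset.Ico l k, moment N Q (2 * i + 2) / moment N Q (2 * i + 1)

/-- Skew-orthogonal polynomials of a radial potential: `ζ^{2k+1}` in odd degrees, even polynomials
in even degrees. -/
def skewPoly (N : ℕ) (Q : ℂ → ℝ) (n : ℕ) : Polynomial ℝ :=
  if n % 2 = 1 then Polynomial.X ^ n
  else ∑ l ∈ Finset.range (n / 2 + 1), Polynomial.C (evenCoeff N Q (n / 2) l) *
    Polynomial.X ^ (2 * l)

theorem evenCoeff_self (k : ℕ) : evenCoeff N Q k k = 1 := by
  rw [evenCoeff, Finset.Ico_self, Finset.prod_empty]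

theorem evenCoeff_eq_div_mul {k l : ℕ} (hlk : l < k) : evenCoeff N Q k l =
    moment N Q (2 * l + 2) / moment N Q (2 * l + 1) * evenCoeff N Q k (l + 1) :=
  Finset.prod_eq_prod_Ico_succ_bot hlk _

theorem skewPoly_odd (k : ℕ) : skewPoly N Q (2 * k + 1) = Polynomial.X ^ (2 * k + 1) := by
  rw [skewPoly, if_pos (by omega)]

theorem skewPoly_even (k : ℕ) : skewPoly N Q (2 * k) =
    ∑ l ∈ Finset.range (k + 1), Polynomial.C (evenCoeff N Q k l) * Polynomial.X ^ (2 * l) := by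
  rw [skewPoly, if_neg (by omega), Nat.mul_div_cancel_left _ two_pos]

theorem coeff_skewPoly_even_odd (k a : ℕ) : (skewPoly N Q (2 * k)).coeff (2 * a + 1) = 0 := by
  rw [skewPoly_even, Polynomial.finsetSum_coeff]
  exact Finset.sum_eq_zero fun l _ => by rw [Polynomial.coeff_C_mul_X_pow, if_neg (by omega)]

theorem coeff_skewPoly_even_even (k a : ℕ) :
    (skewPoly N Q (2 * k)).coeff (2 * a) = if a ≤ k then evenCoeff N Q k a else 0 := by
  rw [skewPoly_even, Polynomial.finsetSum_coeff]
  simp only [Polynomial.coeff_C_mul_X_pow, mul_right_inj' (two_ne_zero' ℕ), Finset.sum_ite_eq,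
    Finset.mem_range, Nat.lt_succ_iff]

theorem degree_skewPoly (n : ℕ) : (skewPoly N Q n).degree = n := by
  obtain ⟨k, rfl | rfl⟩ := Nat.even_or_odd' n
  · have hleading : (skewPoly N Q (2 * k)).coeff (2 * k) ≠ 0 := by
      rw [coeff_skewPoly_even_even, if_pos le_rfl, evenCoeff_self]
      exact one_ne_zero
    refine Polynomial.degree_eq_of_le_of_coeff_ne_zero ?_ hleading
    rw [skewPoly_even]
    refine (Polynomial.degree_sum_le _ _).trans (Finset.sup_le fun l hl => ?_)
    refine (Polynomial.degree_C_mul_X_pow_le _ _).trans ?_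
    have := Finset.mem_range.mp hl
    exact_mod_cast (by omega : 2 * l ≤ 2 * k)
  · rw [skewPoly_odd, Polynomial.degree_X_pow]

theorem IsRadial.skewProduct_skewPoly_odd_even (hr : IsRadial Q) (hQ : HasPolynomialMoments N Q)
    (k l : ℕ) :
    skewProduct N Q (polyFun (skewPoly N Q (2 * k + 1))) (polyFun (skewPoly N Q (2 * l))) =
      if k = l then ((2 * moment N Q (2 * k + 1) : ℝ) : ℂ) else 0 := by
  rw [skewPoly_odd, hr.skewProduct_X_pow_succ hQ, show 2 * k + 2 = 2 * (k + 1) by ring,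
    coeff_skewPoly_even_even, coeff_skewPoly_even_even]
  rcases lt_trichotomy k l with hkl | rfl | hlk
  · rw [if_pos hkl.le, if_pos (Nat.succ_le_of_lt hkl), if_neg hkl.ne, evenCoeff_eq_div_mul hkl]
    have := (hQ.moment_pos (2 * k + 1)).ne'
    rw [show 2 * (k + 1) = 2 * k + 2 by ring, Complex.ofReal_eq_zero]
    field_simp
    ring
  · simp [evenCoeff_self]
  · rw [if_neg (by omega), if_neg (by omega), if_neg hlk.ne']
    simp

theorem IsRadial.isSkewOrthogonal_skewPoly (hr : IsRadial Q) (hQ : HasPolynomialMoments N Q) :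
    IsSkewOrthogonal N Q (skewPoly N Q) (fun k => 2 * moment N Q (2 * k + 1)) where
  degree_eq := degree_skewPoly
  norm_pos k := mul_pos two_pos (hQ.moment_pos _)
  odd_even k l := hr.skewProduct_skewPoly_odd_even hQ k l
  even_odd k l := by
    rw [skewProduct_swap, hr.skewProduct_skewPoly_odd_even hQ, apply_ite Neg.neg, neg_zero]
  odd_odd k l := by
    rw [skewPoly_odd, hr.skewProduct_X_pow_succ hQ, skewPoly_odd, Polynomial.coeff_X_pow,
      Polynomial.coeff_X_pow, if_neg (by omega), if_neg (by omega)]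
    simp
  even_even k l := hr.skewProduct_eq_zero_of_even hQ (coeff_skewPoly_even_odd k)
    (coeff_skewPoly_even_odd l)

theorem polyFun_skewPoly_odd (k : ℕ) (ζ : ℂ) :
    polyFun (skewPoly N Q (2 * k + 1)) ζ = ζ ^ (2 * k + 1) := by
  rw [polyFun, skewPoly_odd, map_pow, Polynomial.aeval_X]

theorem polyFun_skewPoly_even (k : ℕ) (ζ : ℂ) : polyFun (skewPoly N Q (2 * k)) ζ =
    ∑ i ∈ antidiagonal k, (evenCoeff N Q (i.1 + i.2) i.1 : ℂ) * ζ ^ (2 * i.1) := by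
  rw [polyFun, skewPoly_even, Finset.Nat.sum_antidiagonal_eq_sum_range_succ
    (fun l p => (evenCoeff N Q (l + p) l : ℂ) * ζ ^ (2 * l)), map_sum]
  refine Finset.sum_congr rfl fun l hl => ?_
  rw [Nat.add_sub_cancel' (Nat.lt_succ_iff.mp (Finset.mem_range.mp hl))]
  simp

/-- The pairs `(l, p)` with `l + p < N`, which index the monomials of the pre-kernel. -/
def kernelIndices (N : ℕ) : Finset (ℕ × ℕ) := (Finset.range N).biUnion antidiagonal

theorem mem_kernelIndices {i : ℕ × ℕ} : i ∈ kernelIndices N ↔ i.1 + i.2 < N := by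
  simp [kernelIndices]

theorem sum_kernelIndices {M : Type*} [AddCommMonoid M] (N : ℕ) (f : ℕ × ℕ → M) :
    ∑ i ∈ kernelIndices N, f i = ∑ k ∈ Finset.range N, ∑ i ∈ antidiagonal k, f i := by
  refine Finset.sum_biUnion fun k _ l _ hkl => Finset.disjoint_left.mpr fun i hik hil => hkl ?_
  rw [← mem_antidiagonal.mp hik, mem_antidiagonal.mp hil]

theorem preKernel_skewPoly (ζ η : ℂ) :
    preKernel N (skewPoly N Q) (fun k => 2 * moment N Q (2 * k + 1)) ζ η =
      ∑ i ∈ kernelIndices N,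
        ((evenCoeff N Q (i.1 + i.2) i.1 / (2 * moment N Q (2 * (i.1 + i.2) + 1)) : ℝ) : ℂ) *
          (ζ ^ (2 * i.1 + 2 * i.2 + 1) * η ^ (2 * i.1) -
            η ^ (2 * i.1 + 2 * i.2 + 1) * ζ ^ (2 * i.1)) := by
  rw [preKernel, sum_kernelIndices]
  refine Finset.sum_congr rfl fun k _ => ?_
  rw [polyFun_skewPoly_odd, polyFun_skewPoly_odd, polyFun_skewPoly_even, polyFun_skewPoly_even,
    Finset.mul_sum, Finset.sum_mul, ← Finset.sum_sub_distrib, Finset.sum_div]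
  refine Finset.sum_congr rfl fun i hi => ?_
  rw [← mem_antidiagonal.mp hi]
  push_cast
  ring

end RadialPotential

section MittagLefflerPotential

/-! ### Moments of the Mittag-Leffler potential -/

variable {p q b lam c : ℝ} {N : ℕ}

theorem integrable_norm_rpow_mul_exp (hp : 0 < p) (hq : -2 < q) (hb : 0 < b) :
    Integrable fun ζ : ℂ => ‖ζ‖ ^ q * Real.exp (-b * ‖ζ‖ ^ p) := by
  refine (integrable_fun_norm_addHaar volume
    (f := fun r : ℝ => r ^ q * Real.exp (-b * r ^ p))).2 ?_
  refine (integrableOn_rpow_mul_exp_neg_mul_rpow (by linarith : -1 < q + 1) hp hb).congr_fun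
    (fun r hr => ?_) measurableSet_Ioi
  simp only [Complex.finrank_real_complex, Nat.add_one_sub_one, pow_one, smul_eq_mul]
  rw [Real.rpow_add_one (ne_of_gt hr)]
  ring

theorem integral_norm_rpow_mul_exp (hp : 0 < p) (hq : -2 < q) (hb : 0 < b) :
    ∫ ζ : ℂ, ‖ζ‖ ^ q * Real.exp (-b * ‖ζ‖ ^ p) = 2 * Real.pi / p *
      b ^ (-(q + 2) / p) * Real.Gamma ((q + 2) / p) := by
  have hradial : ∫ r in Set.Ioi (0 : ℝ), r * (r ^ q * Real.exp (-b * r ^ p)) =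
      b ^ (-(q + 2) / p) * (1 / p) * Real.Gamma ((q + 2) / p) := by
    rw [show q + 2 = q + 1 + 1 by ring,
      ← integral_rpow_mul_exp_neg_mul_rpow hp (by linarith : -1 < q + 1) hb]
    refine setIntegral_congr_fun measurableSet_Ioi fun r hr => ?_
    rw [Real.rpow_add_one (ne_of_gt hr)]
    ring
  rw [integral_fun_norm_addHaar volume (fun r : ℝ => r ^ q * Real.exp (-b * r ^ p))]
  simp only [Complex.finrank_real_complex, Nat.add_one_sub_one, pow_one, smul_eq_mul, hradial,
    measureReal_def, Complex.volume_ball, ENNReal.ofReal_one, one_pow, one_mul,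
    ENNReal.coe_toReal, NNReal.coe_real_pi, nsmul_eq_mul, Nat.cast_ofNat]
  ring

theorem isRadial_potential : IsRadial (potential lam c N) := fun ζ η h => by
  rw [potential, potential, h]

theorem weight_potential_of_ne_zero (hN : N ≠ 0) {ζ : ℂ} (hζ : ζ ≠ 0) :
    weight N (potential lam c N) ζ =
      ‖ζ‖ ^ (2 * c) * Real.exp (-(N : ℝ) * ‖ζ‖ ^ (2 * lam)) := by
  rw [weight, potential, Real.rpow_def_of_pos (norm_pos_iff.mpr hζ) (2 * c), ← Real.exp_add]
  congr 1
  field_simp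
  ring

theorem norm_pow_mul_weight_potential_ae_eq (hN : N ≠ 0) (k : ℕ) :
    (fun ζ : ℂ => ‖ζ‖ ^ k * weight N (potential lam c N) ζ) =ᵐ[volume]
      fun ζ => ‖ζ‖ ^ ((k : ℝ) + 2 * c) * Real.exp (-(N : ℝ) * ‖ζ‖ ^ (2 * lam)) := by
  filter_upwards [Measure.ae_ne volume (0 : ℂ)] with ζ hζ
  rw [weight_potential_of_ne_zero hN hζ, Real.rpow_add (norm_pos_iff.mpr hζ), Real.rpow_natCast,
    mul_assoc]

theorem hasPolynomialMoments_potential (hlam : 0 < lam) (hc : -1 < c) (hN : N ≠ 0) :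
    HasPolynomialMoments N (potential lam c N) := fun k => by
  have : (0 : ℝ) ≤ k := k.cast_nonneg
  exact (integrable_congr (norm_pow_mul_weight_potential_ae_eq hN k)).2
    (integrable_norm_rpow_mul_exp (by positivity) (by linarith) (by positivity))

theorem moment_potential (hlam : 0 < lam) (hc : -1 < c) (hN : N ≠ 0) (k : ℕ) :
    moment N (potential lam c N) k =
      lam⁻¹ * Real.Gamma ((1 + c + k) / lam) * (N : ℝ) ^ (-((1 + c + k) / lam)) := by
  have : (0 : ℝ) ≤ k := k.cast_nonneg
  have hexponent : (((2 * k : ℕ) : ℝ) + 2 * c + 2) / (2 * lam) = (1 + c + k) / lam := by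
    push_cast
    field_simp
    ring
  rw [moment, integral_congr_ae (norm_pow_mul_weight_potential_ae_eq hN _),
    integral_norm_rpow_mul_exp (by positivity) (by push_cast; linarith) (by positivity),
    neg_div, hexponent]
  field_simp

end MittagLefflerPotential

section GammaQuotients

/-! ### Quotients of Gamma functions -/

variable {m : ℕ} {x a b δ : ℝ}

/-- `Γ(x) / Γ(x + m)`. -/
def gammaRatio (m : ℕ) (x : ℝ) : ℝ := Real.Gamma x / Real.Gamma (x + m)

/-- The product of `p` Gamma quotients along the progression `a, a + 2m, a + 4m, …`: both the
Kilbas–Saigo functions and the pre-kernel have such coefficients. -/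
def iterGammaRatio (m : ℕ) (a : ℝ) (p : ℕ) : ℝ :=
  ∏ i ∈ Finset.range p, gammaRatio m (a + 2 * m * i)

/-- The coefficient `1/Γ(b+2ml) ∏_{i ≤ p} Γ(b+2m(l+i)) / Γ(b+2m(l+i)+m)` of the limiting
pre-kernel. -/
def seriesCoeff (m : ℕ) (b : ℝ) (i : ℕ × ℕ) : ℝ :=
  (Real.Gamma (b + 2 * m * i.1))⁻¹ * iterGammaRatio m (b + 2 * m * i.1) (i.2 + 1)

theorem gammaRatio_pos (m : ℕ) (hx : 0 < x) : 0 < gammaRatio m x :=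
  div_pos (Real.Gamma_pos_of_pos hx) (Real.Gamma_pos_of_pos (by positivity))

theorem iterGammaRatio_pos (m : ℕ) (ha : 0 < a) (p : ℕ) : 0 < iterGammaRatio m a p :=
  Finset.prod_pos fun _ _ => gammaRatio_pos _ (by positivity)

theorem seriesCoeff_pos (m : ℕ) (hb : 0 < b) (i : ℕ × ℕ) : 0 < seriesCoeff m b i :=
  mul_pos (inv_pos.mpr (Real.Gamma_pos_of_pos (by positivity)))
    (iterGammaRatio_pos _ (by positivity) _)

theorem iterGammaRatio_zero (m : ℕ) (a : ℝ) : iterGammaRatio m a 0 = 1 := Finset.prod_range_zero _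

theorem iterGammaRatio_succ (m : ℕ) (a : ℝ) (p : ℕ) :
    iterGammaRatio m a (p + 1) = iterGammaRatio m a p * gammaRatio m (a + 2 * m * p) :=
  Finset.prod_range_succ _ p

theorem iterGammaRatio_succ' (m : ℕ) (a : ℝ) (p : ℕ) :
    iterGammaRatio m a (p + 1) = gammaRatio m a * iterGammaRatio m (a + 2 * m) p := by
  rw [iterGammaRatio, Finset.prod_range_succ', Nat.cast_zero, mul_zero, add_zero, mul_comm,
    iterGammaRatio]
  congr 1
  refine Finset.prod_congr rfl fun i _ => ?_
  push_cast
  ring_nf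

theorem Gamma_add_natCast (n : ℕ) (hx : 0 < x) :
    Real.Gamma (x + n) = Real.Gamma x * ∏ i ∈ Finset.range n, (x + i) := by
  induction n with
  | zero => simp
  | succ n ih =>
    rw [Finset.prod_range_succ, ← mul_assoc, ← ih, Nat.cast_succ, ← add_assoc,
      Real.Gamma_add_one (by positivity), mul_comm]

theorem gammaRatio_eq_inv_prod (m : ℕ) (hx : 0 < x) :
    gammaRatio m x = (∏ i ∈ Finset.range m, (x + i))⁻¹ := by
  have := (Real.Gamma_pos_of_pos hx).ne'
  rw [gammaRatio, Gamma_add_natCast m hx]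
  field_simp

theorem mul_Gamma_le_Gamma_add (hm : m ≠ 0) (hx : 0 < x) :
    x * Real.Gamma x ≤ Real.Gamma (x + m) := by
  obtain ⟨n, rfl⟩ := Nat.exists_eq_succ_of_ne_zero hm
  rw [Gamma_add_natCast _ hx, Finset.prod_range_succ', Nat.cast_zero, add_zero]
  have hprod : 1 ≤ ∏ k ∈ Finset.range n, (x + ((k + 1 : ℕ) : ℝ)) :=
    Finset.one_le_prod fun i _ => by push_cast; linarith [(Nat.cast_nonneg i : (0 : ℝ) ≤ i)]
  nlinarith [mul_pos hx (Real.Gamma_pos_of_pos hx)]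

theorem gammaRatio_le_inv (hm : m ≠ 0) (hx : 0 < x) : gammaRatio m x ≤ x⁻¹ := by
  rw [inv_eq_one_div, gammaRatio,
    div_le_div_iff₀ (Real.Gamma_pos_of_pos (by positivity)) hx, one_mul, mul_comm]
  exact mul_Gamma_le_Gamma_add hm hx

theorem mul_add_one_le_add_two_mul (hm : m ≠ 0) (hδ : δ ≤ 1) (hδa : δ ≤ a) (k : ℕ) :
    δ * (k + 1) ≤ a + 2 * m * k := by
  have hm' : (1 : ℝ) ≤ m := by exact_mod_cast Nat.one_le_iff_ne_zero.mpr hm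
  nlinarith [(k.cast_nonneg : (0 : ℝ) ≤ k)]

theorem iterGammaRatio_le (hm : m ≠ 0) (hδ₀ : 0 < δ) (hδ : δ ≤ 1) (hδa : δ ≤ a) (p : ℕ) :
    iterGammaRatio m a p ≤ δ⁻¹ ^ p / p.factorial := by
  have ha : 0 < a := hδ₀.trans_le hδa
  calc iterGammaRatio m a p ≤ ∏ i ∈ Finset.range p, (δ * ((i : ℝ) + 1))⁻¹ := by
        refine Finset.prod_le_prod (fun i _ => (gammaRatio_pos _ (by positivity)).le) fun i _ => ?_
        exact (gammaRatio_le_inv hm (by positivity)).trans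
          (inv_anti₀ (by positivity) (mul_add_one_le_add_two_mul hm hδ hδa i))
    _ = δ⁻¹ ^ p / p.factorial := by
        simp only [mul_inv, Finset.prod_mul_distrib, Finset.prod_const, Finset.card_range,
          Finset.prod_inv_distrib, div_eq_mul_inv, ← Finset.prod_range_add_one_eq_factorial,
          Nat.cast_prod, Nat.cast_add, Nat.cast_one]

theorem mul_pow_mul_factorial_le_Gamma (hm : m ≠ 0) (hδ₀ : 0 < δ) (hδ : δ ≤ 1) (hδb : δ ≤ b)
    (k : ℕ) : Real.Gamma b * δ ^ k * k.factorial ≤ Real.Gamma (b + 2 * m * k) := by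
  have hb : 0 < b := hδ₀.trans_le hδb
  induction k with
  | zero => simp
  | succ k ih =>
    have := Real.Gamma_pos_of_pos hb
    calc Real.Gamma b * δ ^ (k + 1) * (k + 1).factorial
        = (δ * (k + 1)) * (Real.Gamma b * δ ^ k * k.factorial) := by
          rw [Nat.factorial_succ]
          push_cast
          ring
      _ ≤ (b + 2 * m * k) * Real.Gamma (b + 2 * m * k) := by
          gcongr
          exact mul_add_one_le_add_two_mul hm hδ hδb k
      _ ≤ Real.Gamma (b + 2 * m * k + (2 * m : ℕ)) :=
          mul_Gamma_le_Gamma_add (by omega) (by positivity)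
      _ = Real.Gamma (b + 2 * m * (k + 1 : ℕ)) := by
          push_cast
          ring_nf

theorem inv_Gamma_add_two_mul_le (hm : m ≠ 0) (hδ₀ : 0 < δ) (hδ : δ ≤ 1) (hδb : δ ≤ b) (k : ℕ) :
    (Real.Gamma (b + 2 * m * k))⁻¹ ≤ (Real.Gamma b)⁻¹ * (δ⁻¹ ^ k / k.factorial) := by
  have hΓ := Real.Gamma_pos_of_pos (hδ₀.trans_le hδb)
  refine (inv_anti₀ (by positivity)
    (mul_pow_mul_factorial_le_Gamma hm hδ₀ hδ hδb k)).trans_eq ?_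
  rw [inv_pow]
  field_simp

theorem seriesCoeff_le (hm : m ≠ 0) (hδ₀ : 0 < δ) (hδ : δ ≤ 1) (hδb : δ ≤ b) (i : ℕ × ℕ) :
    seriesCoeff m b i ≤ ((Real.Gamma b)⁻¹ * δ⁻¹) *
      ((δ⁻¹ ^ i.1 / i.1.factorial) * (δ⁻¹ ^ i.2 / i.2.factorial)) := by
  have hb : 0 < b := hδ₀.trans_le hδb
  have := Real.Gamma_pos_of_pos hb
  have hbi : b ≤ b + 2 * m * i.1 := le_add_of_nonneg_right (by positivity)
  have hfactorial : δ⁻¹ ^ (i.2 + 1) / (i.2 + 1).factorial ≤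
      δ⁻¹ * (δ⁻¹ ^ i.2 / i.2.factorial) := by
    rw [pow_succ', mul_div_assoc]
    gcongr
    omega
  calc seriesCoeff m b i ≤ ((Real.Gamma b)⁻¹ * (δ⁻¹ ^ i.1 / i.1.factorial)) *
        (δ⁻¹ * (δ⁻¹ ^ i.2 / i.2.factorial)) :=
        mul_le_mul (inv_Gamma_add_two_mul_le hm hδ₀ hδ hδb i.1)
          ((iterGammaRatio_le hm hδ₀ hδ (hδb.trans hbi) _).trans hfactorial)
          (iterGammaRatio_pos _ (by positivity) _).le (by positivity)
    _ = _ := by ring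

theorem seriesCoeff_eq_prod_Ico (m : ℕ) (hb : 0 < b) (l p : ℕ) :
    seriesCoeff m b (l, p) =
      (∏ i ∈ Finset.Ico l (l + p), Real.Gamma (b + m * (2 * i + 2 : ℕ)) /
        Real.Gamma (b + m * (2 * i + 1 : ℕ))) / Real.Gamma (b + m * (2 * (l + p) + 1 : ℕ)) := by
  have hΓ (n : ℕ) : Real.Gamma (b + m * n) ≠ 0 := (Real.Gamma_pos_of_pos (by positivity)).ne'
  have hratio (p : ℕ) : gammaRatio m (b + 2 * m * l + 2 * m * p) =
      Real.Gamma (b + m * (2 * (l + p) : ℕ)) / Real.Gamma (b + m * (2 * (l + p) + 1 : ℕ)) := by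
    rw [gammaRatio]
    push_cast
    ring_nf
  have hstart : b + 2 * m * l = b + m * (2 * l : ℕ) := by push_cast; ring
  rw [seriesCoeff]
  induction p with
  | zero =>
    rw [zero_add, iterGammaRatio_succ, iterGammaRatio_zero, hratio, add_zero, Finset.Ico_self,
      Finset.prod_empty, hstart, one_mul, inv_mul_eq_div, div_div_cancel_left' (hΓ _), one_div]
  | succ p ih =>
    rw [iterGammaRatio_succ, ← mul_assoc, ih, hratio, ← add_assoc,
      Finset.prod_Ico_succ_top (Nat.le_add_right l p),
      Nat.mul_succ 2 (l + p)]
    ring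

end GammaQuotients

section EntireSeries

/-! ### Everywhere convergent power series -/

variable {ι κ : Type*} {a : ι → ℂ} {α β d : ι → ℕ} {R : ℝ}

/-- A power series in one or several variables, with coefficients `a i` on monomials of total
degree `d i`, converges absolutely everywhere.  Small radii follow from `1 ≤ R`. -/
def IsEntireSeries (a : ι → ℂ) (d : ι → ℕ) : Prop :=
  ∀ R : ℝ, 1 ≤ R → Summable fun i => ‖a i‖ * R ^ d i

/-- The `n`-th derivative of `∑ a_i z^{d_i}`, written termwise. -/
def derivSeries (a : ι → ℂ) (d : ι → ℕ) (n : ℕ) (z : ℂ) : ℂ :=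
  ∑' i, a i * (d i).descFactorial n * z ^ (d i - n)

theorem norm_derivSeries_term_le (hR : 1 ≤ R) {z : ℂ} (hz : ‖z‖ ≤ R) (n : ℕ) (i : ι) :
    ‖a i * (d i).descFactorial n * z ^ (d i - n)‖ ≤ n.factorial * (‖a i‖ * (2 * R) ^ d i) := by
  have hdesc : ((d i).descFactorial n : ℝ) ≤ n.factorial * 2 ^ d i := by
    rw [Nat.descFactorial_eq_factorial_mul_choose]
    exact_mod_cast Nat.mul_le_mul_left _ (Nat.choose_le_two_pow _ _)
  have hpow : ‖z‖ ^ (d i - n) ≤ R ^ d i :=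
    (pow_le_pow_left₀ (norm_nonneg z) hz _).trans (pow_le_pow_right₀ hR (Nat.sub_le _ _))
  calc ‖a i * (d i).descFactorial n * z ^ (d i - n)‖
      = ‖a i‖ * (d i).descFactorial n * ‖z‖ ^ (d i - n) := by
        rw [norm_mul, norm_mul, norm_pow, Complex.norm_natCast]
    _ ≤ ‖a i‖ * (n.factorial * 2 ^ d i) * R ^ d i := by gcongr
    _ = n.factorial * (‖a i‖ * (2 * R) ^ d i) := by rw [mul_pow]; ring

theorem IsEntireSeries.summable_derivSeries (ha : IsEntireSeries a d) (n : ℕ) (z : ℂ) :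
    Summable fun i => a i * (d i).descFactorial n * z ^ (d i - n) :=
  Summable.of_norm_bounded ((ha (2 * (‖z‖ + 1)) (by linarith [norm_nonneg z])).mul_left _)
    (norm_derivSeries_term_le (by linarith [norm_nonneg z]) (by linarith) n)

theorem IsEntireSeries.hasDerivAt_derivSeries (ha : IsEntireSeries a d) (n : ℕ) (z : ℂ) :
    HasDerivAt (derivSeries a d n) (derivSeries a d (n + 1) z) z := by
  have hR : 1 ≤ ‖z‖ + 1 := by linarith [norm_nonneg z]
  refine hasDerivAt_tsum_of_isPreconnected
    (g := fun i y => a i * (d i).descFactorial n * y ^ (d i - n))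
    (g' := fun i y => a i * (d i).descFactorial (n + 1) * y ^ (d i - (n + 1)))
    ((ha (2 * (‖z‖ + 1)) (by linarith)).mul_left _)
    Metric.isOpen_ball (convex_ball (0 : ℂ) (‖z‖ + 1)).isPreconnected (fun i y _ => ?_)
    (fun i y hy => norm_derivSeries_term_le hR (mem_ball_zero_iff.mp hy).le (n + 1) i)
    (Metric.mem_ball_self (by linarith)) (ha.summable_derivSeries n 0)
    (mem_ball_zero_iff.mpr (by linarith))
  convert! (hasDerivAt_pow (d i - n) y).const_mul (a i * (d i).descFactorial n) using 1
  rw [Nat.descFactorial_succ, Nat.sub_sub]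
  push_cast
  ring

theorem IsEntireSeries.continuous_derivSeries (ha : IsEntireSeries a d) (n : ℕ) :
    Continuous (derivSeries a d n) :=
  continuous_iff_continuousAt.mpr fun z => (ha.hasDerivAt_derivSeries n z).continuousAt

theorem IsEntireSeries.iteratedDeriv_derivSeries (ha : IsEntireSeries a d) (n : ℕ) :
    iteratedDeriv n (derivSeries a d 0) = derivSeries a d n := by
  induction n with
  | zero => exact iteratedDeriv_zero
  | succ n ih =>
    rw [iteratedDeriv_succ, ih]
    ext z
    exact (ha.hasDerivAt_derivSeries n z).deriv

theorem norm_pow_mul_pow_le {z w : ℂ} (hz : ‖z‖ ≤ R) (hw : ‖w‖ ≤ R) (k l : ℕ) :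
    ‖z ^ k * w ^ l‖ ≤ R ^ (k + l) := by
  have hR : 0 ≤ R := (norm_nonneg z).trans hz
  rw [norm_mul, norm_pow, norm_pow, pow_add]
  gcongr

theorem norm_natCast_mul_pow_mul_pow_le (hR : 1 ≤ R) {z w : ℂ} (hz : ‖z‖ ≤ R) (hw : ‖w‖ ≤ R)
    (k l : ℕ) : ‖(k : ℂ) * (z ^ (k - 1) * w ^ l)‖ ≤ k * R ^ (k + l) := by
  rw [norm_mul, Complex.norm_natCast]
  gcongr
  exact (norm_pow_mul_pow_le hz hw _ _).trans (pow_le_pow_right₀ hR (by omega))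

theorem exists_hasFDerivAt_pow_mul_pow (hR : 1 ≤ R) {x : ℂ × ℂ} (hx : ‖x‖ ≤ R) (k l : ℕ) :
    ∃ L : ℂ × ℂ →L[ℂ] ℂ, HasFDerivAt (fun y : ℂ × ℂ => y.1 ^ k * y.2 ^ l) L x ∧
      ‖L‖ ≤ (2 * R) ^ (k + l) := by
  have hfst := (norm_fst_le x).trans hx
  have hsnd := (norm_snd_le x).trans hx
  refine ⟨((l : ℂ) * (x.2 ^ (l - 1) * x.1 ^ k)) • ContinuousLinearMap.snd ℂ ℂ ℂ +
    ((k : ℂ) * (x.1 ^ (k - 1) * x.2 ^ l)) • ContinuousLinearMap.fst ℂ ℂ ℂ, ?_, ?_⟩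
  · convert! ((hasFDerivAt_fst (𝕜 := ℂ) (p := x)).pow k).mul
      ((hasFDerivAt_snd (𝕜 := ℂ) (p := x)).pow l) using 1
    simp only [smul_smul, nsmul_eq_mul]
    ring_nf
  · have hdegree : ((k + l : ℕ) : ℝ) ≤ 2 ^ (k + l) := by exact_mod_cast Nat.lt_two_pow_self.le
    refine (norm_add_le _ _).trans ?_
    rw [norm_smul, norm_smul]
    calc _ ≤ l * R ^ (l + k) * 1 + k * R ^ (k + l) * 1 := by
          gcongr
          · exact norm_natCast_mul_pow_mul_pow_le hR hsnd hfst l k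
          · exact ContinuousLinearMap.norm_snd_le ℂ ℂ ℂ
          · exact norm_natCast_mul_pow_mul_pow_le hR hfst hsnd k l
          · exact ContinuousLinearMap.norm_fst_le ℂ ℂ ℂ
      _ = ((k + l : ℕ) : ℝ) * R ^ (k + l) := by push_cast; ring
      _ ≤ 2 ^ (k + l) * R ^ (k + l) := by gcongr
      _ = (2 * R) ^ (k + l) := (mul_pow _ _ _).symm

theorem IsEntireSeries.summable_mul_pow_mul_pow (ha : IsEntireSeries a (α + β)) (u v : ℂ) :
    Summable fun i => a i * (u ^ α i * v ^ β i) := by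
  have hu : ‖u‖ ≤ 1 + ‖u‖ + ‖v‖ := by linarith [norm_nonneg v]
  have hv : ‖v‖ ≤ 1 + ‖u‖ + ‖v‖ := by linarith [norm_nonneg u]
  refine Summable.of_norm_bounded (ha (1 + ‖u‖ + ‖v‖) (by linarith [norm_nonneg u, norm_nonneg v]))
    fun i => ?_
  rw [norm_mul]
  exact mul_le_mul_of_nonneg_left (norm_pow_mul_pow_le hu hv _ _) (norm_nonneg _)

theorem IsEntireSeries.differentiable_tsum_mul_pow_mul_pow (ha : IsEntireSeries a (α + β)) :
    Differentiable ℂ fun x : ℂ × ℂ => ∑' i, a i * (x.1 ^ α i * x.2 ^ β i) := fun x => by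
  have hR : 1 ≤ ‖x‖ + 1 := by linarith [norm_nonneg x]
  choose! L hL hLbound using fun (i : ι) (y : ℂ × ℂ) (hy : ‖y‖ ≤ ‖x‖ + 1) =>
    exists_hasFDerivAt_pow_mul_pow hR hy (α i) (β i)
  refine (hasFDerivAt_tsum_of_isPreconnected (f' := fun i y => a i • L i y)
    (ha (2 * (‖x‖ + 1)) (by linarith)) Metric.isOpen_ball
    (convex_ball (0 : ℂ × ℂ) (‖x‖ + 1)).isPreconnected
    (fun i y hy => (hL i y (mem_ball_zero_iff.mp hy).le).const_mul (a i)) (fun i y hy => ?_)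
    (Metric.mem_ball_self (by linarith)) (ha.summable_mul_pow_mul_pow 0 0)
    (mem_ball_zero_iff.mpr (by linarith))).differentiableAt
  rw [norm_smul]
  exact mul_le_mul_of_nonneg_left (hLbound i y (mem_ball_zero_iff.mp hy).le) (norm_nonneg _)

theorem IsEntireSeries.tendstoLocallyUniformly_sum (ha : IsEntireSeries a (α + β))
    {l : Filter κ} {S : κ → Finset ι} (hS : Tendsto S l atTop) :
    TendstoLocallyUniformly (fun n (x : ℂ × ℂ) => ∑ i ∈ S n, a i * (x.1 ^ α i * x.2 ^ β i))
      (fun x => ∑' i, a i * (x.1 ^ α i * x.2 ^ β i)) l := by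
  rw [tendstoLocallyUniformly_iff_forall_isCompact]
  intro K hK
  obtain ⟨R, hR⟩ := hK.isBounded.exists_norm_le
  have hbound (i : ι) (x : ℂ × ℂ) (hx : x ∈ K) :
      ‖a i * (x.1 ^ α i * x.2 ^ β i)‖ ≤ ‖a i‖ * max R 1 ^ (α + β) i := by
    have hx' : ‖x‖ ≤ max R 1 := (hR x hx).trans (le_max_left _ _)
    rw [norm_mul]
    exact mul_le_mul_of_nonneg_left
      (norm_pow_mul_pow_le ((norm_fst_le x).trans hx') ((norm_snd_le x).trans hx') _ _)
      (norm_nonneg _)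
  intro u hu
  exact hS.eventually (tendstoUniformlyOn_tsum (ha (max R 1) (le_max_right _ _)) hbound u hu)

end EntireSeries

section KernelSeries

/-! ### The double series of the limiting pre-kernel -/

variable {m N : ℕ} {b : ℝ}

/-- One half of the limiting pre-kernel, up to scaling; the other half is obtained by
exchanging the two variables. -/
def halfKernelSeries (m : ℕ) (b : ℝ) (x : ℂ × ℂ) : ℂ :=
  ∑' i : ℕ × ℕ, (seriesCoeff m b i : ℂ) * (x.1 ^ (2 * i.1 + 2 * i.2 + 1) * x.2 ^ (2 * i.1))

/-- The partial sum of `halfKernelSeries` over `l + p < N`. -/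
def halfKernelPartialSum (m : ℕ) (b : ℝ) (N : ℕ) (x : ℂ × ℂ) : ℂ :=
  ∑ i ∈ kernelIndices N,
    (seriesCoeff m b i : ℂ) * (x.1 ^ (2 * i.1 + 2 * i.2 + 1) * x.2 ^ (2 * i.1))

theorem isEntireSeries_seriesCoeff (hm : m ≠ 0) (hb : 0 < b) :
    IsEntireSeries (fun i : ℕ × ℕ => (seriesCoeff m b i : ℂ))
      ((fun i => 2 * i.1 + 2 * i.2 + 1) + fun i => 2 * i.1) := fun R hR => by
  obtain ⟨δ, hδ₀, hδ, hδb⟩ : ∃ δ : ℝ, 0 < δ ∧ δ ≤ 1 ∧ δ ≤ b :=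
    ⟨min 1 b, lt_min one_pos hb, min_le_left _ _, min_le_right _ _⟩
  have hexp := ((Real.summable_pow_div_factorial (δ⁻¹ * R ^ 4)).mul_of_nonneg
    (Real.summable_pow_div_factorial (δ⁻¹ * R ^ 2)) (fun _ => by positivity)
    (fun _ => by positivity)).mul_left ((Real.Gamma b)⁻¹ * δ⁻¹ * R)
  refine hexp.of_nonneg_of_le (fun i => by positivity) fun i => ?_
  rw [Complex.norm_real, Real.norm_of_nonneg (seriesCoeff_pos m hb i).le]
  refine (mul_le_mul_of_nonneg_right (seriesCoeff_le hm hδ₀ hδ hδb i)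
    (by positivity)).trans_eq ?_
  simp only [Pi.add_apply, mul_pow]
  ring

theorem differentiable_halfKernelSeries (hm : m ≠ 0) (hb : 0 < b) :
    Differentiable ℂ (halfKernelSeries m b) :=
  (isEntireSeries_seriesCoeff hm hb).differentiable_tsum_mul_pow_mul_pow

theorem tendsto_kernelIndices : Tendsto kernelIndices atTop atTop := by
  refine tendsto_atTop_finset_of_monotone (fun M N hMN i hi => ?_) fun i =>
    ⟨i.1 + i.2 + 1, mem_kernelIndices.mpr (Nat.lt_succ_self _)⟩
  exact mem_kernelIndices.mpr ((mem_kernelIndices.mp hi).trans_le hMN)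

theorem tendstoLocallyUniformly_halfKernelPartialSum (hm : m ≠ 0) (hb : 0 < b) :
    TendstoLocallyUniformly (halfKernelPartialSum m b) (halfKernelSeries m b) atTop :=
  (isEntireSeries_seriesCoeff hm hb).tendstoLocallyUniformly_sum tendsto_kernelIndices

end KernelSeries

section Scaling

/-! ### The rescaled pre-kernel is a partial sum of the double series -/

variable {m N : ℕ} {c : ℝ}

/-- The constant `(2m)^{m/2}` with `r_N = (2m)^{m/2} N^{-m/2}`. -/
def scaleConst (m : ℕ) : ℝ := (2 * (m : ℝ)) ^ ((m : ℝ) / 2)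

/-- The entire function `P(z,w)` with `κ(z,w) = (zw)^c P(z,w)`. -/
def entireKernel (m : ℕ) (c : ℝ) (x : ℂ × ℂ) : ℂ :=
  ((scaleConst m * (2 * (m : ℝ)) ^ (m * (1 + c) - 1) : ℝ) : ℂ) *
    (halfKernelSeries m (m * (1 + c)) ((scaleConst m : ℂ) • x) -
      halfKernelSeries m (m * (1 + c)) ((scaleConst m : ℂ) • x.swap))

theorem natCast_mul_one_add_pos (hm : m ≠ 0) (hc : -1 < c) : 0 < (m : ℝ) * (1 + c) :=
  mul_pos (by positivity) (by linarith)

theorem microScale_pos {lam : ℝ} (hlam : 0 < lam) (hN : N ≠ 0) : 0 < microScale lam N :=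
  Real.rpow_pos_of_pos (by positivity) _

theorem microScale_eq_scaleConst_mul (hm : m ≠ 0) :
    microScale (1 / (m : ℝ)) N = scaleConst m * (N : ℝ) ^ (-((m : ℝ) / 2)) := by
  rw [microScale, scaleConst, Real.mul_rpow (by positivity) (by positivity),
    show 1 / (m : ℝ) / 2 = (2 * (m : ℝ))⁻¹ by field_simp,
    show -(1 / (2 * (1 / (m : ℝ)))) = -((m : ℝ) / 2) by field_simp,
    Real.inv_rpow (by positivity), ← Real.rpow_neg (by positivity), neg_neg]

theorem microScale_rpow_two_mul (hm : m ≠ 0) :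
    microScale (1 / (m : ℝ)) N ^ (2 * (1 + c)) =
      (2 * (m : ℝ)) ^ (m * (1 + c)) * (N : ℝ) ^ (-(m * (1 + c))) := by
  rw [microScale, show 1 / (m : ℝ) / 2 = (2 * (m : ℝ))⁻¹ by field_simp,
    ← Real.rpow_mul (by positivity), Real.mul_rpow (by positivity) (by positivity),
    show -(1 / (2 * (1 / (m : ℝ)))) * (2 * (1 + c)) = -(m * (1 + c)) by field_simp,
    Real.inv_rpow (by positivity), ← Real.rpow_neg (by positivity), neg_neg]

theorem moment_potential_one_div (hm : m ≠ 0) (hc : -1 < c) (hN : N ≠ 0) (k : ℕ) :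
    moment N (potential (1 / (m : ℝ)) c N) k = m * Real.Gamma (m * (1 + c) + m * k) *
      ((N : ℝ) ^ (-(m * (1 + c))) * ((N : ℝ) ^ (-((m : ℝ) / 2))) ^ (2 * k)) := by
  have hN' : (0 : ℝ) < N := by positivity
  rw [moment_potential (by positivity) hc hN, ← Real.rpow_natCast, ← Real.rpow_mul hN'.le,
    ← Real.rpow_add hN', show (1 + c + k) / (1 / (m : ℝ)) = m * (1 + c) + m * k by field_simp,
    one_div, inv_inv]
  congr 2
  push_cast
  ring

theorem evenCoeff_potential_one_div (hm : m ≠ 0) (hc : -1 < c) (hN : N ≠ 0) (l p : ℕ) :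
    evenCoeff N (potential (1 / (m : ℝ)) c N) (l + p) l =
      (∏ i ∈ Finset.Ico l (l + p), Real.Gamma (m * (1 + c) + m * (2 * i + 2 : ℕ)) /
        Real.Gamma (m * (1 + c) + m * (2 * i + 1 : ℕ))) *
        ((N : ℝ) ^ (-((m : ℝ) / 2))) ^ (2 * p) := by
  have hb := natCast_mul_one_add_pos hm hc
  have hquotient (i : ℕ) : moment N (potential (1 / (m : ℝ)) c N) (2 * i + 2) /
      moment N (potential (1 / (m : ℝ)) c N) (2 * i + 1) =
      Real.Gamma (m * (1 + c) + m * (2 * i + 2 : ℕ)) /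
        Real.Gamma (m * (1 + c) + m * (2 * i + 1 : ℕ)) * ((N : ℝ) ^ (-((m : ℝ) / 2))) ^ 2 := by
    have : Real.Gamma (m * (1 + c) + m * (2 * i + 1 : ℕ)) ≠ 0 :=
      (Real.Gamma_pos_of_pos (by positivity)).ne'
    rw [moment_potential_one_div hm hc hN, moment_potential_one_div hm hc hN]
    field_simp
    ring
  rw [evenCoeff, Finset.prod_congr rfl fun i _ => hquotient i, Finset.prod_mul_distrib,
    Finset.prod_const, Nat.card_Ico, Nat.add_sub_cancel_left, ← pow_mul]

theorem evenCoeff_div_moment (hm : m ≠ 0) (hc : -1 < c) (hN : N ≠ 0) (l p : ℕ) :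
    evenCoeff N (potential (1 / (m : ℝ)) c N) (l + p) l /
        moment N (potential (1 / (m : ℝ)) c N) (2 * (l + p) + 1) *
        ((N : ℝ) ^ (-((m : ℝ) / 2))) ^ (4 * l + 2 * p + 2) =
      seriesCoeff m (m * (1 + c)) (l, p) * ((N : ℝ) ^ (-(m * (1 + c))))⁻¹ / m := by
  have hb := natCast_mul_one_add_pos hm hc
  have : Real.Gamma (m * (1 + c) + m * (2 * (l + p) + 1 : ℕ)) ≠ 0 :=
    (Real.Gamma_pos_of_pos (by positivity)).ne'
  rw [evenCoeff_potential_one_div hm hc hN, moment_potential_one_div hm hc hN,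
    seriesCoeff_eq_prod_Ico m hb]
  field_simp
  ring

theorem microScale_mul_evenCoeff (hm : m ≠ 0) (hc : -1 < c) (hN : N ≠ 0) (l p : ℕ) :
    microScale (1 / (m : ℝ)) N ^ (2 * c) * microScale (1 / (m : ℝ)) N ^ 3 *
      (evenCoeff N (potential (1 / (m : ℝ)) c N) (l + p) l /
        (2 * moment N (potential (1 / (m : ℝ)) c N) (2 * (l + p) + 1)) *
        microScale (1 / (m : ℝ)) N ^ (4 * l + 2 * p + 1)) =
      scaleConst m * (2 * (m : ℝ)) ^ (m * (1 + c) - 1) *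
        (seriesCoeff m (m * (1 + c)) (l, p) * scaleConst m ^ (4 * l + 2 * p + 1)) := by
  have hr : 0 < microScale (1 / (m : ℝ)) N := microScale_pos (by positivity) hN
  have hpow : microScale (1 / (m : ℝ)) N ^ (2 * c) * microScale (1 / (m : ℝ)) N ^ 3 *
      microScale (1 / (m : ℝ)) N ^ (4 * l + 2 * p + 1) =
      microScale (1 / (m : ℝ)) N ^ (2 * (1 + c)) *
        microScale (1 / (m : ℝ)) N ^ (4 * l + 2 * p + 2) := by
    rw [mul_add 2 1 c, mul_one, Real.rpow_add hr, Real.rpow_two]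
    ring
  calc _ = microScale (1 / (m : ℝ)) N ^ (2 * c) * microScale (1 / (m : ℝ)) N ^ 3 *
          microScale (1 / (m : ℝ)) N ^ (4 * l + 2 * p + 1) *
          (evenCoeff N (potential (1 / (m : ℝ)) c N) (l + p) l /
            moment N (potential (1 / (m : ℝ)) c N) (2 * (l + p) + 1)) / 2 := by
        field_simp
    _ = (2 * (m : ℝ)) ^ (m * (1 + c)) * (N : ℝ) ^ (-(m * (1 + c))) *
          scaleConst m ^ (4 * l + 2 * p + 2) *
          (evenCoeff N (potential (1 / (m : ℝ)) c N) (l + p) l /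
            moment N (potential (1 / (m : ℝ)) c N) (2 * (l + p) + 1) *
            ((N : ℝ) ^ (-((m : ℝ) / 2))) ^ (4 * l + 2 * p + 2)) / 2 := by
        rw [hpow, microScale_rpow_two_mul hm, microScale_eq_scaleConst_mul hm, mul_pow]
        ring
    _ = _ := by
        have hNb : (N : ℝ) ^ (-(m * (1 + c))) ≠ 0 := (Real.rpow_pos_of_pos (by positivity) _).ne'
        rw [evenCoeff_div_moment hm hc hN, Real.rpow_sub_one (by positivity)]
        field_simp
        ring

theorem microScale_rpow_mul_rescaledPreKernel_skewPoly (hm : m ≠ 0) (hc : -1 < c) (hN : N ≠ 0)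
    (x : ℂ × ℂ) :
    ((microScale (1 / (m : ℝ)) N ^ (2 * c) : ℝ) : ℂ) *
      rescaledPreKernel (1 / (m : ℝ)) N (skewPoly N (potential (1 / (m : ℝ)) c N))
        (fun k => 2 * moment N (potential (1 / (m : ℝ)) c N) (2 * k + 1)) x.1 x.2 =
    ((scaleConst m * (2 * (m : ℝ)) ^ (m * (1 + c) - 1) : ℝ) : ℂ) *
      (halfKernelPartialSum m (m * (1 + c)) N ((scaleConst m : ℂ) • x) -
        halfKernelPartialSum m (m * (1 + c)) N ((scaleConst m : ℂ) • x.swap)) := by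
  rw [rescaledPreKernel, preKernel_skewPoly, halfKernelPartialSum, halfKernelPartialSum,
    ← Finset.sum_sub_distrib, Finset.mul_sum, Finset.mul_sum, Finset.mul_sum]
  refine Finset.sum_congr rfl fun ⟨l, p⟩ _ => ?_
  have hcoeff := congrArg (fun t : ℝ => (t : ℂ)) (microScale_mul_evenCoeff hm hc hN l p)
  push_cast at hcoeff ⊢
  simp only [Prod.smul_fst, Prod.smul_snd, Prod.fst_swap, Prod.snd_swap, smul_eq_mul, mul_pow]
  linear_combination (x.1 ^ (2 * l + 2 * p + 1) * x.2 ^ (2 * l) -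
    x.2 ^ (2 * l + 2 * p + 1) * x.1 ^ (2 * l)) * hcoeff

end Scaling

section Convergence

/-! ### Convergence of the pre-kernels -/

variable {m : ℕ} {c : ℝ}

theorem differentiable_entireKernel (hm : m ≠ 0) (hc : -1 < c) :
    Differentiable ℂ (entireKernel m c) := by
  have hseries := differentiable_halfKernelSeries hm (natCast_mul_one_add_pos hm hc)
  unfold entireKernel
  exact ((hseries.fun_comp (g := halfKernelSeries m (m * (1 + c)))
    (f := fun x : ℂ × ℂ => (scaleConst m : ℂ) • x) (by fun_prop)).sub
    (hseries.fun_comp (f := fun x : ℂ × ℂ => (scaleConst m : ℂ) • x.swap)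
      ((differentiable_snd.prodMk differentiable_fst).fun_const_smul _))).const_mul _

theorem tendstoLocallyUniformly_rescaledPreKernel (hm : m ≠ 0) (hc : -1 < c)
    {q : ℕ → ℕ → Polynomial ℝ} {s : ℕ → ℕ → ℝ}
    (h : ∀ N : ℕ, 1 ≤ N → IsSkewOrthogonal N (potential (1 / (m : ℝ)) c N) (q N) (s N)) :
    TendstoLocallyUniformly
      (fun (N : ℕ) (x : ℂ × ℂ) => ((microScale (1 / (m : ℝ)) N ^ (2 * c) : ℝ) : ℂ) *
        rescaledPreKernel (1 / (m : ℝ)) N (q N) (s N) x.1 x.2)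
      (entireKernel m c) atTop := by
  have hseries := tendstoLocallyUniformly_halfKernelPartialSum hm (natCast_mul_one_add_pos hm hc)
  have hkernel := (uniformContinuous_const_smul
    ((scaleConst m * (2 * (m : ℝ)) ^ (m * (1 + c) - 1) : ℝ) : ℂ)).comp_tendstoLocallyUniformly
    ((hseries.comp (fun x : ℂ × ℂ => (scaleConst m : ℂ) • x) (by fun_prop)).sub
      (hseries.comp (fun x : ℂ × ℂ => (scaleConst m : ℂ) • x.swap) (by fun_prop)))
  refine hkernel.congr_inseparable ?_
  filter_upwards [eventually_ge_atTop 1] with N hN x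
  have hN' : N ≠ 0 := Nat.one_le_iff_ne_zero.mp hN
  have hmoments := hasPolynomialMoments_potential (c := c) (lam := 1 / (m : ℝ))
    (by positivity) hc hN'
  refine .of_eq ?_
  rw [rescaledPreKernel, (h N hN).preKernel_eq (isRadial_potential.isSkewOrthogonal_skewPoly
    hmoments) hmoments]
  exact (microScale_rpow_mul_rescaledPreKernel_skewPoly hm hc hN' x).symm

end Convergence

section KernelMatrices

/-! ### Convergence of the kernel matrices -/

theorem tendstoLocallyUniformly_iff_tendsto {ι α β : Type*} [TopologicalSpace α] [UniformSpace β]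
    {F : ι → α → β} {f : α → β} {p : Filter ι} (hf : Continuous f) :
    TendstoLocallyUniformly F f p ↔
      ∀ x, Tendsto (fun y : ι × α => F y.1 y.2) (p ×ˢ 𝓝 x) (𝓝 (f x)) := by
  rw [tendstoLocallyUniformly_iff_forall_tendsto]
  refine forall_congr' fun x => ?_
  have hfx : Tendsto (fun y : ι × α => f y.2) (p ×ˢ 𝓝 x) (𝓝 (f x)) :=
    (hf.tendsto x).comp tendsto_snd
  exact ⟨hfx.congr_uniformity, fun h => (hfx.prodMk_nhds h).mono_right (nhds_le_uniformity _)⟩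

theorem tendstoLocallyUniformly_comp_prodMk {ι α β γ : Type*} [TopologicalSpace α]
    [UniformSpace β] [UniformSpace γ] {F : ι → α → β} {f : α → β} {p : Filter ι} {φ : α × β → γ}
    (h : TendstoLocallyUniformly F f p) (hf : Continuous f) (hφ : Continuous φ) :
    TendstoLocallyUniformly (fun i x => φ (x, F i x)) (fun x => φ (x, f x)) p := by
  rw [tendstoLocallyUniformly_iff_tendsto hf] at h
  refine (tendstoLocallyUniformly_iff_tendsto (hφ.comp (continuous_id.prodMk hf))).mpr ?_
  exact fun x => (hφ.tendsto (x, f x)).comp (tendsto_snd.prodMk_nhds (h x))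

variable {κ : ℂ → ℂ → ℂ} {lam c : ℝ} {N : ℕ}

theorem continuous_kernelMatrix (hκ : Continuous fun p : ℂ × ℂ => κ p.1 p.2) :
    Continuous fun p : ℂ × ℂ => kernelMatrix κ p.1 p.2 := by
  refine continuous_matrix fun i j => ?_
  fin_cases i <;> fin_cases j
  · exact hκ
  · exact hκ.comp (by fun_prop : Continuous fun p : ℂ × ℂ => (p.1, conj p.2))
  · exact hκ.comp (by fun_prop : Continuous fun p : ℂ × ℂ => (conj p.1, p.2))
  · exact hκ.comp (by fun_prop : Continuous fun p : ℂ × ℂ => (conj p.1, conj p.2))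

theorem tendstoLocallyUniformly_kernelMatrix {ι : Type*} {l : Filter ι} {κ' : ι → ℂ → ℂ → ℂ}
    (hκ : Continuous fun p : ℂ × ℂ => κ p.1 p.2)
    (h : TendstoLocallyUniformly (fun i (p : ℂ × ℂ) => κ' i p.1 p.2) (fun p => κ p.1 p.2) l) :
    TendstoLocallyUniformly (fun i (p : ℂ × ℂ) => kernelMatrix (κ' i) p.1 p.2)
      (fun p => kernelMatrix κ p.1 p.2) l := by
  have hcomp {γ : ℂ × ℂ → ℂ × ℂ} (hγ : Continuous γ) (x : ℂ × ℂ) :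
      Tendsto (fun y : ι × (ℂ × ℂ) => κ' y.1 (γ y.2).1 (γ y.2).2) (l ×ˢ 𝓝 x)
        (𝓝 (κ (γ x).1 (γ x).2)) :=
    (tendstoLocallyUniformly_iff_tendsto (hκ.comp hγ)).mp (h.comp γ hγ) x
  rw [tendstoLocallyUniformly_iff_tendsto (continuous_kernelMatrix hκ)]
  refine fun x => tendsto_pi_nhds.mpr fun i => tendsto_pi_nhds.mpr fun j => ?_
  fin_cases i <;> fin_cases j
  · exact hcomp continuous_id x
  · exact hcomp (by fun_prop : Continuous fun p : ℂ × ℂ => (p.1, conj p.2)) x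
  · exact hcomp (by fun_prop : Continuous fun p : ℂ × ℂ => (conj p.1, p.2)) x
  · exact hcomp (by fun_prop : Continuous fun p : ℂ × ℂ => (conj p.1, conj p.2)) x

theorem tendstoLocallyUniformly_limitKernel {ι : Type*} {l : Filter ι} {κ' : ι → ℂ → ℂ → ℂ}
    (hκ : Continuous fun p : ℂ × ℂ => κ p.1 p.2)
    (h : TendstoLocallyUniformly (fun i (p : ℂ × ℂ) => κ' i p.1 p.2) (fun p => κ p.1 p.2) l) :
    TendstoLocallyUniformly (fun i (p : ℂ × ℂ) => limitKernel lam (κ' i) p.1 p.2)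
      (fun p => limitKernel lam κ p.1 p.2) l := by
  have hpow : Continuous fun Z : ℂ => ‖Complex.exp Z‖ ^ (2 * lam) :=
    Complex.continuous_exp.norm.rpow_const
      fun Z => Or.inl (norm_ne_zero_iff.mpr (Complex.exp_ne_zero Z))
  have hfactor : Continuous fun p : ℂ × ℂ => (Real.exp
      (-((‖Complex.exp p.1‖ ^ (2 * lam) + ‖Complex.exp p.2‖ ^ (2 * lam)) / lam)) : ℂ) := by
    have hsum := (hpow.comp continuous_fst).add (hpow.comp continuous_snd)
    exact Complex.continuous_ofReal.comp (Real.continuous_exp.comp (hsum.div_const lam).neg)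
  exact tendstoLocallyUniformly_comp_prodMk (tendstoLocallyUniformly_kernelMatrix hκ h)
    (continuous_kernelMatrix hκ) ((hfactor.comp continuous_fst).smul continuous_snd)

theorem microScale_rpow_two_mul_self (hlam : 0 < lam) :
    microScale lam N ^ (2 * lam) = (lam / 2 * N)⁻¹ := by
  rw [microScale, ← Real.rpow_mul (by positivity), ← Real.rpow_neg_one]
  congr 1
  field_simp

theorem half_mul_potential (hlam : 0 < lam) (hN : N ≠ 0) (Z : ℂ) :
    -((N : ℝ) / 2) * potential lam c N (microScale lam N * Complex.exp Z) =
      -(‖Complex.exp Z‖ ^ (2 * lam) / lam) + (Real.log (microScale lam N) * c + c * Z.re) := by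
  have hr := microScale_pos hlam hN
  rw [potential, norm_mul, Complex.norm_real, Real.norm_of_nonneg hr.le,
    Real.mul_rpow hr.le (norm_nonneg _), microScale_rpow_two_mul_self hlam,
    Real.log_mul hr.ne' (norm_ne_zero_iff.mpr (Complex.exp_ne_zero _)), Complex.norm_exp,
    Real.log_exp]
  field_simp
  ring

theorem exp_neg_half_mul_potential (hlam : 0 < lam) (hN : N ≠ 0) (Z W : ℂ) :
    Real.exp (-((N : ℝ) / 2) * (potential lam c N (microScale lam N * Complex.exp Z) +
        potential lam c N (microScale lam N * Complex.exp W))) =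
      Real.exp (-((‖Complex.exp Z‖ ^ (2 * lam) + ‖Complex.exp W‖ ^ (2 * lam)) / lam)) *
        (Real.exp (c * Z.re + c * W.re) * microScale lam N ^ (2 * c)) := by
  rw [mul_add, half_mul_potential hlam hN, half_mul_potential hlam hN,
    Real.rpow_def_of_pos (microScale_pos hlam hN), ← Real.exp_add, ← Real.exp_add]
  congr 1
  ring

theorem exp_mul_re_add_mul_unimodular (c : ℝ) (Z W : ℂ) :
    (Real.exp (c * Z.re + c * W.re) : ℂ) * (unimodular c Z * unimodular c W) =
      Complex.exp (c * (Z + W)) := by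
  rw [unimodular, unimodular, Complex.ofReal_exp, ← Complex.exp_add, ← Complex.exp_add]
  congr 1
  conv_rhs => rw [← Complex.re_add_im Z, ← Complex.re_add_im W]
  push_cast
  ring

theorem finiteKernel_eq_limitKernel (hlam : 0 < lam) (hN : N ≠ 0) (q : ℕ → Polynomial ℝ)
    (s : ℕ → ℝ) (Z W : ℂ) :
    finiteKernel lam c N q s Z W = limitKernel lam (fun U V => Complex.exp (c * (U + V)) *
      (((microScale lam N ^ (2 * c) : ℝ) : ℂ) *
        rescaledPreKernel lam N q s (Complex.exp U) (Complex.exp V))) Z W := by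
  have hentry {U V : ℂ} (hU : U.re = Z.re) (hV : V.re = W.re) (A r κ : ℂ) :
      A * (((Real.exp (c * Z.re + c * W.re) : ℝ) : ℂ) * r) * (unimodular c U * unimodular c V * κ) =
        A * (Complex.exp (c * (U + V)) * (r * κ)) := by
    rw [← exp_mul_re_add_mul_unimodular, hU, hV]
    ring
  rw [finiteKernel, limitKernel, exp_neg_half_mul_potential hlam hN, Complex.ofReal_mul,
    Complex.ofReal_mul]
  ext i j
  fin_cases i <;> fin_cases j
  · exact hentry rfl rfl _ _ _
  · exact hentry rfl (Complex.conj_re _) _ _ _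
  · exact hentry (Complex.conj_re _) rfl _ _ _
  · exact hentry (Complex.conj_re _) (Complex.conj_re _) _ _ _

theorem tendstoLocallyUniformly_finiteKernel (hlam : 0 < lam) {q : ℕ → ℕ → Polynomial ℝ}
    {s : ℕ → ℕ → ℝ} {P : ℂ × ℂ → ℂ} (hP : Continuous P)
    (h : TendstoLocallyUniformly (fun (N : ℕ) (x : ℂ × ℂ) =>
      ((microScale lam N ^ (2 * c) : ℝ) : ℂ) * rescaledPreKernel lam N (q N) (s N) x.1 x.2)
      P atTop)
    (hκ : ∀ Z W, κ Z W = Complex.exp (c * (Z + W)) * P (Complex.exp Z, Complex.exp W)) :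
    TendstoLocallyUniformly
      (fun (N : ℕ) (p : ℂ × ℂ) => finiteKernel lam c N (q N) (s N) p.1 p.2)
      (fun p => limitKernel lam κ p.1 p.2) atTop := by
  obtain rfl : κ = fun Z W => Complex.exp (c * (Z + W)) * P (Complex.exp Z, Complex.exp W) :=
    funext₂ hκ
  have hexp : Continuous fun p : ℂ × ℂ => (Complex.exp p.1, Complex.exp p.2) := by fun_prop
  have hpower : Continuous fun p : ℂ × ℂ => Complex.exp (c * (p.1 + p.2)) := by fun_prop
  have hpre := tendstoLocallyUniformly_comp_prodMk (h.comp _ hexp) (hP.comp hexp)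
    ((hpower.comp continuous_fst).mul continuous_snd)
  refine (tendstoLocallyUniformly_limitKernel (lam := lam)
    (κ := fun Z W => Complex.exp (c * (Z + W)) * P (Complex.exp Z, Complex.exp W))
    (κ' := fun N Z W => Complex.exp (c * (Z + W)) * (((microScale lam N ^ (2 * c) : ℝ) : ℂ) *
      rescaledPreKernel lam N (q N) (s N) (Complex.exp Z) (Complex.exp W)))
    (hpower.mul (hP.comp hexp)) hpre).congr_inseparable ?_
  filter_upwards [eventually_ne_atTop 0] with N hN p
  exact .of_eq (finiteKernel_eq_limitKernel hlam hN (q N) (s N) p.1 p.2).symm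

end KernelMatrices

section CyclicRowSystems

/-! ### Determinants of matrices whose rows differentiate cyclically -/

variable {𝕜 ι : Type*} [NontriviallyNormedField 𝕜] [Fintype ι] [DecidableEq ι]
  {M : 𝕜 → Matrix ι ι 𝕜} {c : ι → 𝕜} {σ : Equiv.Perm ι} {t : 𝕜}

theorem hasDerivAt_det {M' : Matrix ι ι 𝕜}
    (h : ∀ i j, HasDerivAt (fun s => M s i j) (M' i j) t) :
    HasDerivAt (fun s => (M s).det) (∑ i, ((M t).updateRow i (M' i)).det) t := by
  let D : ContinuousMultilinearMap 𝕜 (fun _ : ι => ι → 𝕜) 𝕜 :=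
    { (Matrix.detRowAlternating (n := ι) (R := 𝕜)).toMultilinearMap with
      cont := Continuous.matrix_det continuous_id }
  have hM : HasDerivAt (fun s i => M s i) (fun i => M' i) t :=
    hasDerivAt_pi.mpr fun i => hasDerivAt_pi.mpr (h i)
  have hD := (D.hasFDerivAt fun i => M t i).comp_hasDerivAt t hM
  rwa [D.linearDeriv_apply] at hD

theorem det_updateRow_row_of_ne (A : Matrix ι ι 𝕜) {i j : ι} (hij : i ≠ j) :
    (A.updateRow i (A j)).det = 0 :=
  Matrix.det_zero_of_row_eq hij
    (by rw [Matrix.updateRow_self, Matrix.updateRow_ne hij.symm])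

theorem det_updateRow_updateRow_row_swap (A : Matrix ι ι 𝕜) (v : ι → 𝕜) {i j : ι} (hij : i ≠ j) :
    ((A.updateRow i v).updateRow j (A i)).det = -(A.updateRow j v).det := by
  have hswap : (A.updateRow i v).updateRow j (A i) =
      (A.updateRow j v).submatrix (Equiv.swap i j) id := by
    ext k l
    rcases eq_or_ne k j with rfl | hkj
    · simp [hij]
    rcases eq_or_ne k i with rfl | hki
    · simp [hkj]
    · simp [hkj, hki, Equiv.swap_apply_of_ne_of_ne hki hkj]
  rw [hswap, Matrix.det_permute, Equiv.Perm.sign_swap hij]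
  simp

theorem hasDerivAt_det_of_cyclic (hσ : ∀ k, σ k ≠ k)
    (h : ∀ k l, HasDerivAt (fun s => M s k l) (c k * M t (σ k) l) t) :
    HasDerivAt (fun s => (M s).det) 0 t := by
  convert! hasDerivAt_det (M' := Matrix.of fun k l => c k * M t (σ k) l) h using 1
  refine (Finset.sum_eq_zero fun k _ => ?_).symm
  change ((M t).updateRow k (c k • M t (σ k))).det = 0
  rw [Matrix.det_updateRow_smul, det_updateRow_row_of_ne _ (hσ k).symm, mul_zero]

theorem hasDerivAt_det_updateRow_of_cyclic (hσ : ∀ k, σ k ≠ k)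
    (h : ∀ k l, HasDerivAt (fun s => M s k l) (c k * M t (σ k) l) t) (v : ι → 𝕜) (i : ι) :
    HasDerivAt (fun s => ((M s).updateRow (σ i) v).det)
      (-(c i * ((M t).updateRow i v).det)) t := by
  let M' : Matrix ι ι 𝕜 :=
    Matrix.of fun k => if k = σ i then 0 else c k • M t (σ k)
  have hM' : ∀ k l, HasDerivAt (fun s => (M s).updateRow (σ i) v k l) (M' k l) t := by
    intro k l
    by_cases hk : k = σ i
    · subst hk
      simpa [M'] using hasDerivAt_const t (v l)
    · simpa [M', hk, Matrix.updateRow_ne] using h k l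
  convert! hasDerivAt_det hM' using 1
  rw [Finset.sum_eq_single i (fun k _ hki => ?_) (by simp)]
  · change _ = (((M t).updateRow (σ i) v).updateRow i (if i = σ i then 0 else c i • M t (σ i))).det
    rw [if_neg (hσ i).symm, Matrix.det_updateRow_smul,
      det_updateRow_updateRow_row_swap _ _ (hσ i), mul_neg]
  · by_cases hk : k = σ i
    · exact Matrix.det_eq_zero_of_row_eq_zero k fun l => by simp [M', hk]
    · change (((M t).updateRow (σ i) v).updateRow k
        (if k = σ i then 0 else c k • M t (σ k))).det = 0
      have hrow : M t (σ k) = (M t).updateRow (σ i) v (σ k) :=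
        (Matrix.updateRow_ne (σ.injective.ne hki)).symm
      rw [if_neg hk, Matrix.det_updateRow_smul, hrow, det_updateRow_row_of_ne _ (hσ k).symm,
        mul_zero]

end CyclicRowSystems

section KilbasSaigo

/-! ### The functions `g_{j,m}` and the equation `y^{(m)} = t^m y` -/

variable {m r i : ℕ}

theorem isEntireSeries_of_norm_le_pow_div_factorial {a : ℕ → ℂ} {C B : ℝ}
    (h : ∀ k, ‖a k‖ ≤ C * (B ^ k / k.factorial)) (p q : ℕ) :
    IsEntireSeries a fun k => p * k + q := fun R hR => by
  refine ((Real.summable_pow_div_factorial (B * R ^ p)).mul_left (C * R ^ q)).of_nonneg_of_le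
    (fun k => by positivity) fun k => ?_
  calc ‖a k‖ * R ^ (p * k + q) ≤ C * (B ^ k / k.factorial) * R ^ (p * k + q) := by
        gcongr
        exact h k
    _ = C * R ^ q * ((B * R ^ p) ^ k / k.factorial) := by rw [pow_add, pow_mul]; ring

/-- The `i`-th derivative of `g_{r+1,m}`. -/
def gDeriv (m r i : ℕ) : ℂ → ℂ :=
  derivSeries (fun k => (iterGammaRatio m (m + r + 1) k : ℂ)) (fun k => 2 * m * k + r) i

theorem isEntireSeries_iterGammaRatio (hm : m ≠ 0) (r : ℕ) :
    IsEntireSeries (fun k => (iterGammaRatio m (m + r + 1) k : ℂ)) fun k => 2 * m * k + r := by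
  refine isEntireSeries_of_norm_le_pow_div_factorial (C := 1) (B := 1⁻¹) (fun k => ?_) _ _
  have hm1 : (1 : ℝ) ≤ m + r + 1 := by
    have : (0 : ℝ) ≤ m + r := by positivity
    linarith
  rw [Complex.norm_real, Real.norm_of_nonneg (iterGammaRatio_pos m (by positivity) k).le, one_mul]
  exact iterGammaRatio_le hm one_pos le_rfl hm1 k

theorem hasDerivAt_gDeriv (hm : m ≠ 0) (r i : ℕ) (z : ℂ) :
    HasDerivAt (gDeriv m r i) (gDeriv m r (i + 1) z) z :=
  (isEntireSeries_iterGammaRatio hm r).hasDerivAt_derivSeries i z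

theorem g_succ (hm : m ≠ 0) (r : ℕ) : g m (r + 1) = gDeriv m r 0 := by
  have hcoeff (k : ℕ) : (∏ j ∈ Finset.range k,
      ((Real.Gamma (m * (j * 2 + (1 + (((r + 1 : ℕ) : ℝ) - 1) / m)) + 1) /
        Real.Gamma (m * (j * 2 + (1 + (((r + 1 : ℕ) : ℝ) - 1) / m) + 1) + 1) : ℝ) : ℂ)) =
      iterGammaRatio m (m + r + 1) k := by
    rw [iterGammaRatio, Complex.ofReal_prod]
    refine Finset.prod_congr rfl fun j _ => ?_
    rw [gammaRatio]
    congr 3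
    · push_cast; field_simp; ring
    · push_cast; field_simp; ring
  ext z
  rw [g, kilbasSaigo, gDeriv, derivSeries, ← tsum_mul_left]
  refine tsum_congr fun k => ?_
  rw [hcoeff, Nat.descFactorial_zero, Nat.sub_zero, Nat.add_sub_cancel, pow_add, ← pow_mul]
  push_cast
  ring

theorem iteratedDeriv_g (hm : m ≠ 0) (r i : ℕ) : iteratedDeriv i (g m (r + 1)) = gDeriv m r i := by
  rw [g_succ hm]
  exact (isEntireSeries_iterGammaRatio hm r).iteratedDeriv_derivSeries i

theorem iterGammaRatio_succ_mul_descFactorial (m r k : ℕ) :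
    iterGammaRatio m (m + r + 1) (k + 1) * (2 * m * (k + 1) + r).descFactorial m =
      iterGammaRatio m (m + r + 1) k := by
  have hpos : 0 < ∏ i ∈ Finset.range m, ((m : ℝ) + r + 1 + 2 * m * k + i) :=
    Finset.prod_pos fun i _ => by positivity
  have hdesc : ((2 * m * (k + 1) + r).descFactorial m : ℝ) =
      ∏ i ∈ Finset.range m, ((m : ℝ) + r + 1 + 2 * m * k + i) := by
    rw [show 2 * m * (k + 1) + r = (2 * m * k + m + r) + m by ring,
      Nat.add_descFactorial_eq_ascFactorial, Nat.ascFactorial_eq_prod_range]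
    push_cast
    exact Finset.prod_congr rfl fun i _ => by ring
  rw [iterGammaRatio_succ, gammaRatio_eq_inv_prod m (by positivity), hdesc, mul_assoc,
    inv_mul_cancel₀ hpos.ne', mul_one]

theorem gDeriv_self (hr : r < m) (z : ℂ) : gDeriv m r m z = z ^ m * gDeriv m r 0 z := by
  have hsum := (isEntireSeries_iterGammaRatio (Nat.ne_zero_of_lt hr) r).summable_derivSeries m z
  rw [gDeriv, derivSeries, hsum.tsum_eq_zero_add, mul_zero, zero_add,
    Nat.descFactorial_eq_zero_iff_lt.mpr hr, Nat.cast_zero, mul_zero, zero_mul, zero_add, gDeriv,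
    derivSeries, ← tsum_mul_left]
  refine tsum_congr fun k => ?_
  rw [← iterGammaRatio_succ_mul_descFactorial m r k, Nat.descFactorial_zero, Nat.sub_zero,
    show 2 * m * (k + 1) + r - m = m + (2 * m * k + r) by rw [mul_add]; omega, pow_add]
  push_cast
  ring

theorem gDeriv_apply_zero (hi : i < m) :
    gDeriv m r i 0 = if i = r then (r.factorial : ℂ) else 0 := by
  rw [gDeriv, derivSeries, tsum_eq_single 0]
  · rw [mul_zero, zero_add]
    rcases lt_trichotomy i r with hir | rfl | hir
    · rw [if_neg hir.ne, zero_pow (by omega), mul_zero]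
    · simp [iterGammaRatio_zero, Nat.descFactorial_self]
    · simp [Nat.descFactorial_eq_zero_iff_lt.mpr hir, hir.ne']
  · intro k hk
    have : 2 * m * 1 ≤ 2 * m * k := Nat.mul_le_mul_left _ (Nat.one_le_iff_ne_zero.mpr hk)
    rw [zero_pow (by omega), mul_zero]

end KilbasSaigo

section FundamentalMatrix

/-! ### The fundamental matrix and its Cauchy function -/

variable {m n : ℕ}

/-- The fundamental matrix `(g_{k+1,m}^{(i)}(t))_{i,k}` of the equation `y^{(m)} = t^m y`. -/
def fundMatrix (m : ℕ) (t : ℂ) : Matrix (Fin m) (Fin m) ℂ :=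
  Matrix.of fun i k => gDeriv m k i t

theorem hasDerivAt_fundMatrix (i k : Fin (n + 1)) (t : ℂ) :
    HasDerivAt (fun s => fundMatrix (n + 1) s i k)
      ((if i = Fin.last n then t ^ (n + 1) else 1) *
        fundMatrix (n + 1) t (finRotate (n + 1) i) k) t := by
  convert! hasDerivAt_gDeriv n.succ_ne_zero k i t using 1
  by_cases hi : i = Fin.last n
  · subst hi
    rw [if_pos rfl, finRotate_last, Fin.val_last, gDeriv_self k.2]
    rfl
  · rw [if_neg hi, one_mul, ← coe_finRotate_of_ne_last hi]
    rfl

theorem finRotate_ne_self (hn : n ≠ 0) (i : Fin (n + 1)) : finRotate (n + 1) i ≠ i := by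
  obtain ⟨n, rfl⟩ := Nat.exists_eq_succ_of_ne_zero hn
  rw [finRotate_apply]
  exact add_ne_left.mpr one_ne_zero

theorem fundMatrix_zero :
    fundMatrix m 0 = Matrix.diagonal fun i : Fin m => ((i : ℕ).factorial : ℂ) := by
  ext i k
  rw [fundMatrix, Matrix.of_apply, gDeriv_apply_zero i.2, Matrix.diagonal_apply]
  by_cases hik : i = k
  · simp [hik]
  · rw [if_neg hik, if_neg fun h => hik (Fin.ext h)]

theorem barnesG_ne_zero (m : ℕ) : barnesG m ≠ 0 :=
  Finset.prod_ne_zero_iff.mpr fun i _ => by exact_mod_cast i.factorial_ne_zero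

theorem barnesG_succ (n : ℕ) : barnesG (n + 1) = ∏ i : Fin (n + 1), ((i : ℕ).factorial : ℂ) := by
  rw [Fin.prod_univ_eq_prod_range (fun i => (i.factorial : ℂ)),
    Finset.prod_range_eq_mul_Ico _ n.succ_pos, Nat.factorial_zero, Nat.cast_one, one_mul]
  rfl

theorem det_fundMatrix (hn : n ≠ 0) (t : ℂ) : (fundMatrix (n + 1) t).det = barnesG (n + 1) := by
  have h (s : ℂ) : HasDerivAt (fun t => (fundMatrix (n + 1) t).det) 0 s :=
    hasDerivAt_det_of_cyclic (finRotate_ne_self hn) fun i k => hasDerivAt_fundMatrix i k s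
  rw [is_const_of_deriv_eq_zero (fun s => (h s).differentiableAt) (fun s => (h s).deriv) t 0,
    fundMatrix_zero, Matrix.det_diagonal, barnesG_succ]

/-- `K` solves the first-order system adjoint to `y^{(n+1)} = t^{n+1} y`, with the initial value
`(1, 0, …, 0)` at `x`.  Then `K (Fin.last n)` is the Cauchy function `k(x, ·)` of the equation. -/
structure IsAdjointSolution (n : ℕ) (x : ℂ) (K : Fin (n + 1) → ℂ → ℂ) : Prop where
  apply_self : ∀ i, K i x = if i = 0 then 1 else 0
  hasDerivAt_zero : ∀ t, HasDerivAt (K 0) (-(t ^ (n + 1) * K (Fin.last n) t)) t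
  hasDerivAt_succ : ∀ (i : Fin n) (t : ℂ), HasDerivAt (K i.succ) (-K i.castSucc t) t

theorem IsAdjointSolution.continuous {x : ℂ} {K : Fin (n + 1) → ℂ → ℂ}
    (hK : IsAdjointSolution n x K) (i : Fin (n + 1)) : Continuous (K i) := by
  refine continuous_iff_continuousAt.mpr fun t => ?_
  cases i using Fin.cases with
  | zero => exact (hK.hasDerivAt_zero t).continuousAt
  | succ i => exact (hK.hasDerivAt_succ i t).continuousAt

/-- The `i`-th entry of the row vector `(Φ(x) Φ(t)⁻¹)_{0,·}`, `Φ = fundMatrix (n + 1)`, written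
with Cramer's rule. -/
def adjointSolution (n : ℕ) (x : ℂ) (i : Fin (n + 1)) (t : ℂ) : ℂ :=
  ((fundMatrix (n + 1) t).updateRow i (fundMatrix (n + 1) x 0)).det / barnesG (n + 1)

theorem hasDerivAt_adjointSolution (hn : n ≠ 0) (x : ℂ) (i : Fin (n + 1)) (t : ℂ) :
    HasDerivAt (adjointSolution n x (finRotate (n + 1) i))
      (-((if i = Fin.last n then t ^ (n + 1) else 1) * adjointSolution n x i t)) t := by
  convert! (hasDerivAt_det_updateRow_of_cyclic (finRotate_ne_self hn)
    (fun i k => hasDerivAt_fundMatrix i k t) (fundMatrix (n + 1) x 0) i).div_const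
    (barnesG (n + 1)) using 1
  rw [adjointSolution, neg_div, mul_div_assoc]

theorem isAdjointSolution_adjointSolution (hn : n ≠ 0) (x : ℂ) :
    IsAdjointSolution n x (adjointSolution n x) where
  apply_self i := by
    by_cases hi : i = 0
    · subst hi
      rw [if_pos rfl, adjointSolution, Matrix.updateRow_eq_self, det_fundMatrix hn,
        div_self (barnesG_ne_zero _)]
    · rw [if_neg hi, adjointSolution, det_updateRow_row_of_ne _ hi, zero_div]
  hasDerivAt_zero t := by
    simpa only [finRotate_last, if_true] using hasDerivAt_adjointSolution hn x (Fin.last n) t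
  hasDerivAt_succ i t := by
    have hrotate : finRotate (n + 1) i.castSucc = i.succ := finRotate_of_lt i.2
    simpa only [hrotate, i.castSucc_ne_last, if_false, one_mul] using
      hasDerivAt_adjointSolution hn x i.castSucc t

theorem isAdjointSolution_gaussian (x : ℂ) :
    IsAdjointSolution 0 x fun _ t => Complex.exp (1 / 2 * (x ^ 2 - t ^ 2)) where
  apply_self i := by simp [Fin.fin_one_eq_zero i]
  hasDerivAt_zero t := by
    convert! (((hasDerivAt_pow 2 t).const_sub (x ^ 2)).const_mul (1 / 2)).cexp using 1
    push_cast
    ring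
  hasDerivAt_succ i := i.elim0

theorem det_submatrix_fundMatrix (k : Fin (n + 1)) (t : ℂ) :
    ((fundMatrix (n + 1) t).submatrix (Fin.last n).succAbove k.succAbove).det =
      Wminor (n + 1) (k + 1) t := by
  rw [Wminor, wronskian]
  change _ = Matrix.det (n := Fin n) _
  congr 1
  ext i l
  have hindex : (if (l : ℕ) + 1 < k + 1 then (l : ℕ) + 1 else l + 2) = k.succAbove l + 1 := by
    simp only [Fin.succAbove, Fin.lt_def, Fin.val_castSucc, add_lt_add_iff_right]
    split_ifs <;> rfl
  simp only [Matrix.submatrix_apply, Fin.succAbove_last, fundMatrix, Matrix.of_apply, hindex,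
    iteratedDeriv_g n.succ_ne_zero, Fin.val_castSucc]

theorem continuous_Wminor (hm : m ≠ 0) (j : ℕ) : Continuous (Wminor m j) := by
  refine Continuous.matrix_det (continuous_matrix fun i k => ?_)
  have hg (r : ℕ) : Continuous (iteratedDeriv i (g m (r + 1))) := by
    rw [iteratedDeriv_g hm]
    exact continuous_iff_continuousAt.mpr fun t => (hasDerivAt_gDeriv hm r i t).continuousAt
  simp only [Matrix.of_apply]
  split_ifs
  exacts [hg k, hg (k + 1)]

theorem sum_g_mul_Wminor (n : ℕ) (x t : ℂ) :
    ∑ j ∈ Finset.Icc 1 (n + 1), (-1 : ℂ) ^ (n + 1 - j) / barnesG (n + 1) *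
      (g (n + 1) j x * Wminor (n + 1) j t) = adjointSolution n x (Fin.last n) t := by
  rw [adjointSolution, Matrix.det_succ_row _ (Fin.last n), Finset.sum_div,
    ← Finset.Ico_add_one_right_eq_Icc, Finset.sum_Ico_eq_sum_range, Nat.add_sub_cancel,
    ← Fin.sum_univ_eq_sum_range (fun k => (-1 : ℂ) ^ (n + 1 - (1 + k)) / barnesG (n + 1) *
      (g (n + 1) (1 + k) x * Wminor (n + 1) (1 + k) t))]
  refine Finset.sum_congr rfl fun k _ => ?_
  have hsign : (-1 : ℂ) ^ (n + (k : ℕ)) = (-1) ^ (n + 1 - (1 + k)) := by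
    rw [show n + (k : ℕ) = (n + 1 - (1 + k)) + 2 * k by omega, pow_add, pow_mul]
    simp
  rw [Matrix.submatrix_updateRow_succAbove, det_submatrix_fundMatrix, Matrix.updateRow_self,
    Fin.val_last, hsign, add_comm 1 (k : ℕ), g_succ n.succ_ne_zero, fundMatrix, Matrix.of_apply,
    Fin.val_zero]
  ring

end FundamentalMatrix

section PowerMoments

/-! ### Power moments -/

variable {k k' ψ : ℝ → ℂ} {a : ℝ}

/-- The moment `∫₀¹ s^a ψ(s) ds`. -/
def powerMoment (ψ : ℝ → ℂ) (a : ℝ) : ℂ := ∫ s in (0 : ℝ)..1, ((s ^ a : ℝ) : ℂ) * ψ s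

theorem intervalIntegrable_rpow_mul (hψ : Continuous ψ) (ha : -1 < a) :
    IntervalIntegrable (fun s : ℝ => ((s ^ a : ℝ) : ℂ) * ψ s) volume 0 1 :=
  have hrpow := intervalIntegral.intervalIntegrable_rpow' (a := 0) (b := 1) ha
  IntervalIntegrable.mul_continuousOn ⟨hrpow.1.ofReal, hrpow.2.ofReal⟩ hψ.continuousOn

theorem powerMoment_const_mul (x : ℂ) (ψ : ℝ → ℂ) (a : ℝ) :
    powerMoment (fun s => x * ψ s) a = x * powerMoment ψ a := by
  rw [powerMoment, powerMoment, ← intervalIntegral.integral_const_mul]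
  simp only [mul_left_comm]

theorem powerMoment_pow_mul (ψ : ℝ → ℂ) (n : ℕ) (ha : -1 < a) :
    powerMoment (fun s => (s : ℂ) ^ n * ψ s) (a + 1) = powerMoment ψ (a + 1 + n) := by
  refine intervalIntegral.integral_congr fun s hs => ?_
  rw [Set.uIcc_of_le zero_le_one] at hs
  have hexp : a + 1 + n ≠ 0 := by
    have : (0 : ℝ) ≤ n := n.cast_nonneg
    linarith
  simp only [Real.rpow_add_natCast' hs.1 hexp]
  push_cast
  ring

theorem add_one_mul_powerMoment (hk : ∀ s, HasDerivAt k (k' s) s) (hk' : Continuous k')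
    (ha : -1 < a) :
    ((a + 1 : ℝ) : ℂ) * powerMoment k a = k 1 - powerMoment k' (a + 1) := by
  have hcont : Continuous k := continuous_iff_continuousAt.mpr fun s => (hk s).continuousAt
  have hprod : Continuous fun s : ℝ => ((s ^ (a + 1) : ℝ) : ℂ) * k s :=
    (Complex.continuous_ofReal.comp (Real.continuous_rpow_const (by linarith))).mul hcont
  have hint := (intervalIntegrable_rpow_mul hcont ha).const_mul ((a + 1 : ℝ) : ℂ)
  have hint' := intervalIntegrable_rpow_mul hk' (by linarith : -1 < a + 1)
  have hderiv (s : ℝ) (hs : s ∈ Set.Ioo (0 : ℝ) 1) :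
      HasDerivAt (fun s : ℝ => ((s ^ (a + 1) : ℝ) : ℂ) * k s)
        (((a + 1 : ℝ) : ℂ) * (((s ^ a : ℝ) : ℂ) * k s) + ((s ^ (a + 1) : ℝ) : ℂ) * k' s) s := by
    convert! (Real.hasDerivAt_rpow_const (p := a + 1) (Or.inl hs.1.ne')).ofReal_comp.mul (hk s)
      using 1
    rw [add_sub_cancel_right]
    push_cast
    ring
  have hftc := intervalIntegral.integral_eq_sub_of_hasDerivAt_of_le zero_le_one
    hprod.continuousOn hderiv (hint.add hint')
  rw [intervalIntegral.integral_add hint hint', intervalIntegral.integral_const_mul,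
    Real.zero_rpow (by linarith : a + 1 ≠ 0)] at hftc
  rw [powerMoment, powerMoment, eq_sub_iff_add_eq, hftc]
  simp

theorem exists_norm_powerMoment_le (hψ : Continuous ψ) :
    ∃ B, ∀ a : ℝ, 0 ≤ a → ‖powerMoment ψ a‖ ≤ B := by
  obtain ⟨B, hB⟩ := (isCompact_Icc (a := (0 : ℝ)) (b := 1)).exists_bound_of_continuousOn
    hψ.continuousOn
  refine ⟨B, fun a ha => (intervalIntegral.norm_integral_le_of_norm_le_const (C := B)
    fun s hs => ?_).trans_eq (by simp)⟩
  rw [Set.uIoc_of_le zero_le_one] at hs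
  rw [norm_mul, Complex.norm_real, Real.norm_of_nonneg (Real.rpow_nonneg hs.1.le _)]
  calc s ^ a * ‖ψ s‖ ≤ 1 * ‖ψ s‖ := by gcongr; exact Real.rpow_le_one hs.1.le hs.2 ha
    _ ≤ B := (one_mul _).trans_le (hB s ⟨hs.1.le, hs.2⟩)

end PowerMoments

section MomentRecursion

/-! ### Power moments of the Cauchy function -/

variable {m n : ℕ} {x : ℂ} {a b : ℝ} {ψ : ℝ → ℂ} {K : Fin (n + 1) → ℂ → ℂ}

/-- The power moments of `ψ` satisfy the two-term recursion with step `2m` which, iterated,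
produces the Gamma quotients of the double series in powers of `x`. -/
structure HasGammaMoments (m : ℕ) (x : ℂ) (ψ : ℝ → ℂ) : Prop where
  continuous : Continuous ψ
  powerMoment_eq : ∀ a : ℝ, -1 < a → powerMoment ψ a =
    gammaRatio m (a + 1) * x ^ m * (1 + x ^ m * powerMoment ψ (a + 2 * m))

theorem HasGammaMoments.powerMoment_eq_sum_add (hψ : HasGammaMoments m x ψ) (hb : 0 < b) (p : ℕ) :
    powerMoment ψ (b - 1) =
      ∑ i ∈ Finset.range p, (iterGammaRatio m b (i + 1) : ℂ) * x ^ (m + 2 * m * i) +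
        iterGammaRatio m b p * x ^ (2 * m * p) * powerMoment ψ (b + 2 * m * p - 1) := by
  induction p with
  | zero => simp [iterGammaRatio_zero]
  | succ p ih =>
    have hpos : 0 < b + 2 * m * p := by positivity
    rw [ih, hψ.powerMoment_eq _ (by linarith), sub_add_cancel, Finset.sum_range_succ,
      iterGammaRatio_succ,
      show b + 2 * m * p - 1 + 2 * m = b + 2 * m * (p + 1 : ℕ) - 1 by push_cast; ring]
    push_cast
    ring

theorem summable_iterGammaRatio_mul_pow (hm : m ≠ 0) (hb : 0 < b) (y : ℂ) :
    Summable fun p => (iterGammaRatio m b p : ℂ) * y ^ p := by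
  obtain ⟨δ, hδ₀, hδ, hδb⟩ : ∃ δ : ℝ, 0 < δ ∧ δ ≤ 1 ∧ δ ≤ b :=
    ⟨min 1 b, lt_min one_pos hb, min_le_left _ _, min_le_right _ _⟩
  refine Summable.of_norm_bounded (Real.summable_pow_div_factorial (δ⁻¹ * ‖y‖)) fun p => ?_
  rw [norm_mul, Complex.norm_real, Real.norm_of_nonneg (iterGammaRatio_pos m hb p).le, norm_pow,
    mul_pow, mul_div_right_comm]
  gcongr
  exact iterGammaRatio_le hm hδ₀ hδ hδb p

theorem HasGammaMoments.tendsto_remainder (hψ : HasGammaMoments m x ψ) (hm : m ≠ 0) (hb : 0 < b) :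
    Tendsto (fun p : ℕ => iterGammaRatio m b p * x ^ (2 * m * p) *
      powerMoment ψ (b + 2 * m * p - 1)) atTop (𝓝 0) := by
  obtain ⟨B, hB⟩ := exists_norm_powerMoment_le hψ.continuous
  have hzero :=
    (summable_iterGammaRatio_mul_pow hm hb (x ^ (2 * m))).tendsto_atTop_zero.norm.mul_const B
  rw [norm_zero, zero_mul] at hzero
  refine squeeze_zero_norm' ?_ hzero
  filter_upwards [eventually_ge_atTop 1] with p hp
  have hmp : (1 : ℝ) ≤ (m * p : ℕ) := by
    exact_mod_cast Nat.mul_pos (Nat.pos_of_ne_zero hm) hp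
  push_cast at hmp
  rw [norm_mul, pow_mul]
  refine mul_le_mul_of_nonneg_left (hB _ ?_) (norm_nonneg _)
  linarith

theorem HasGammaMoments.hasSum_powerMoment (hψ : HasGammaMoments m x ψ) (hm : m ≠ 0) (hb : 0 < b) :
    HasSum (fun p : ℕ => (iterGammaRatio m b (p + 1) : ℂ) * x ^ (m + 2 * m * p))
      (powerMoment ψ (b - 1)) := by
  have hsummable :
      Summable fun p : ℕ => (iterGammaRatio m b (p + 1) : ℂ) * x ^ (m + 2 * m * p) := by
    refine ((summable_iterGammaRatio_mul_pow hm (by positivity : 0 < b + 2 * m)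
      (x ^ (2 * m))).mul_left (gammaRatio m b * x ^ m)).congr fun p => ?_
    rw [iterGammaRatio_succ', pow_add, pow_mul x (2 * m)]
    push_cast
    ring
  refine hsummable.hasSum_iff_tendsto_nat.mpr ?_
  have hlim := (tendsto_const_nhds (x := powerMoment ψ (b - 1))).sub (hψ.tendsto_remainder hm hb)
  rw [sub_zero] at hlim
  refine hlim.congr fun p => ?_
  rw [hψ.powerMoment_eq_sum_add hb p, add_sub_cancel_right]

theorem hasDerivAt_comp_ofReal_mul {f : ℂ → ℂ} {f' : ℂ} {s : ℝ}
    (h : HasDerivAt f f' ((s : ℂ) * x)) :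
    HasDerivAt (fun s : ℝ => f ((s : ℂ) * x)) (x * f') s := by
  convert! (h.comp (s : ℂ) ((hasDerivAt_id (s : ℂ)).mul_const x)).comp_ofReal using 1
  ring

theorem IsAdjointSolution.continuous_comp (hK : IsAdjointSolution n x K) (i : Fin (n + 1)) :
    Continuous fun s : ℝ => K i (s * x) :=
  (hK.continuous i).comp (by fun_prop)

theorem IsAdjointSolution.add_one_mul_powerMoment_succ (hK : IsAdjointSolution n x K) (i : Fin n)
    (ha : -1 < a) :
    ((a + 1 : ℝ) : ℂ) * powerMoment (fun s => K i.succ (s * x)) a =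
      x * powerMoment (fun s => K i.castSucc (s * x)) (a + 1) := by
  have hderiv (s : ℝ) : HasDerivAt (fun s : ℝ => K i.succ (s * x))
      (-x * K i.castSucc (s * x)) s := by
    simpa only [mul_neg, neg_mul] using hasDerivAt_comp_ofReal_mul (hK.hasDerivAt_succ i (s * x))
  rw [add_one_mul_powerMoment hderiv ((hK.continuous_comp i.castSucc).const_mul _) ha,
    Complex.ofReal_one, one_mul, hK.apply_self, if_neg (Fin.succ_ne_zero i),
    powerMoment_const_mul]
  ring

theorem IsAdjointSolution.add_one_mul_powerMoment_zero (hK : IsAdjointSolution n x K)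
    (ha : -1 < a) :
    ((a + 1 : ℝ) : ℂ) * powerMoment (fun s => K 0 (s * x)) a =
      1 + x ^ (n + 2) * powerMoment (fun s => K (Fin.last n) (s * x)) (a + 1 + (n + 1 : ℕ)) := by
  have hderiv (s : ℝ) : HasDerivAt (fun s : ℝ => K 0 (s * x))
      (-x ^ (n + 2) * ((s : ℂ) ^ (n + 1) * K (Fin.last n) (s * x))) s := by
    convert! hasDerivAt_comp_ofReal_mul (hK.hasDerivAt_zero (s * x)) using 1
    ring
  rw [add_one_mul_powerMoment hderiv
    (((by fun_prop : Continuous fun s : ℝ => (s : ℂ) ^ (n + 1)).mul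
      (hK.continuous_comp (Fin.last n))).const_mul _) ha,
    Complex.ofReal_one, one_mul, hK.apply_self, if_pos rfl, powerMoment_const_mul,
    powerMoment_pow_mul _ _ ha]
  ring

theorem IsAdjointSolution.prod_mul_powerMoment (hK : IsAdjointSolution n x K) (i : Fin (n + 1))
    (ha : -1 < a) :
    ((∏ j ∈ Finset.range i, (a + 1 + j) : ℝ) : ℂ) * powerMoment (fun s => K i (s * x)) a =
      x ^ (i : ℕ) * powerMoment (fun s => K 0 (s * x)) (a + (i : ℕ)) := by
  induction i using Fin.induction generalizing a with
  | zero => simp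
  | succ i ih =>
    have hshift : ∏ j ∈ Finset.range i, (a + 1 + (j + 1 : ℕ)) =
        ∏ j ∈ Finset.range i, (a + 1 + 1 + j) :=
      Finset.prod_congr rfl fun j _ => by push_cast; ring
    have hi := ih (by linarith : -1 < a + 1)
    rw [Fin.val_castSucc] at hi
    rw [Fin.val_succ, Finset.prod_range_succ', hshift, Nat.cast_zero, add_zero, Complex.ofReal_mul,
      mul_assoc, hK.add_one_mul_powerMoment_succ i ha, mul_left_comm, hi,
      show a + 1 + ((i : ℕ) : ℝ) = a + ((i : ℕ) + 1 : ℕ) by push_cast; ring]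
    ring

theorem IsAdjointSolution.hasGammaMoments (hK : IsAdjointSolution n x K) :
    HasGammaMoments (n + 1) x fun s => x * K (Fin.last n) (s * x) where
  continuous := (hK.continuous_comp (Fin.last n)).const_mul x
  powerMoment_eq a ha := by
    have : (0 : ℝ) ≤ n := n.cast_nonneg
    have hlast := hK.prod_mul_powerMoment (Fin.last n) ha
    have hzero := hK.add_one_mul_powerMoment_zero (by linarith : -1 < a + n)
    have hpos : 0 < ∏ j ∈ Finset.range (n + 1), (a + 1 + j) :=
      Finset.prod_pos fun j _ => by
        have : (0 : ℝ) ≤ j := j.cast_nonneg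
        linarith
    rw [Fin.val_last] at hlast
    rw [show a + n + 1 + (n + 1 : ℕ) = a + 2 * (n + 1 : ℕ) by push_cast; ring] at hzero
    have hprod : ((∏ j ∈ Finset.range (n + 1), (a + 1 + j) : ℝ) : ℂ) *
        powerMoment (fun s => K (Fin.last n) (s * x)) a = x ^ n * (1 + x ^ (n + 2) *
          powerMoment (fun s => K (Fin.last n) (s * x)) (a + 2 * (n + 1 : ℕ))) := by
      rw [← hzero, Finset.prod_range_succ]
      push_cast at hlast ⊢
      linear_combination (a + 1 + n : ℂ) * hlast
    have hne : ((∏ j ∈ Finset.range (n + 1), (a + 1 + j) : ℝ) : ℂ) ≠ 0 := by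
      exact_mod_cast hpos.ne'
    simp only [powerMoment_const_mul]
    generalize powerMoment (fun s => K (Fin.last n) (s * x)) = J at hprod ⊢
    rw [gammaRatio_eq_inv_prod _ (by linarith), Complex.ofReal_inv]
    field_simp
    linear_combination x * hprod

end MomentRecursion

section MittagLefflerIntegrals

/-! ### Integrals against `F` -/

variable {m : ℕ} {b c : ℝ} {ψ φ : ℝ → ℂ}

/-- The Taylor coefficient `1 / Γ(b + 2mk)` of `E_{2m,b}`. -/
def invGammaCoeff (m : ℕ) (b : ℝ) (k : ℕ) : ℂ := ((Real.Gamma (b + 2 * m * k))⁻¹ : ℝ)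

/-- The entire function `z ↦ E_{2m,b}(z^{2m})`, as a lacunary power series in `z`. -/
def mittagLefflerPow (m : ℕ) (b : ℝ) : ℂ → ℂ :=
  derivSeries (invGammaCoeff m b) (fun k => 2 * m * k) 0

theorem isEntireSeries_invGammaCoeff (hm : m ≠ 0) (hb : 0 < b) :
    IsEntireSeries (invGammaCoeff m b) fun k => 2 * m * k := by
  obtain ⟨δ, hδ₀, hδ, hδb⟩ : ∃ δ : ℝ, 0 < δ ∧ δ ≤ 1 ∧ δ ≤ b :=
    ⟨min 1 b, lt_min one_pos hb, min_le_left _ _, min_le_right _ _⟩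
  refine isEntireSeries_of_norm_le_pow_div_factorial (C := (Real.Gamma b)⁻¹) (B := δ⁻¹)
    (fun k => ?_) (2 * m) 0
  have hpos : 0 < Real.Gamma (b + 2 * m * k) := Real.Gamma_pos_of_pos (by positivity)
  rw [invGammaCoeff, Complex.norm_real, Real.norm_of_nonneg (inv_pos.mpr hpos).le]
  exact inv_Gamma_add_two_mul_le hm hδ₀ hδ hδb k

theorem hasSum_mittagLefflerPow (hm : m ≠ 0) (hb : 0 < b) (z : ℂ) :
    HasSum (fun k => invGammaCoeff m b k * z ^ (2 * m * k)) (mittagLefflerPow m b z) := by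
  simpa only [mittagLefflerPow, derivSeries, Nat.descFactorial_zero, Nat.cast_one, mul_one,
    Nat.sub_zero] using ((isEntireSeries_invGammaCoeff hm hb).summable_derivSeries 0 z).hasSum

theorem continuous_mittagLefflerPow (hm : m ≠ 0) (hb : 0 < b) :
    Continuous (mittagLefflerPow m b) :=
  (isEntireSeries_invGammaCoeff hm hb).continuous_derivSeries 0

theorem mittagLeffler_pow (m : ℕ) (b : ℝ) (z : ℂ) :
    mittagLeffler (2 * m) b (z ^ (2 * m)) = mittagLefflerPow m b z := by
  refine tsum_congr fun k => ?_
  rw [Nat.descFactorial_zero, Nat.cast_one, mul_one, Nat.sub_zero, invGammaCoeff, add_comm b,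
    ← pow_mul, Complex.ofReal_inv, div_eq_inv_mul]

theorem FML_log_add (m : ℕ) (c : ℝ) (Z W : ℂ) {s : ℝ} (hs : 0 < s) :
    FML m c (Real.log s + Z + W) =
      Complex.exp (((m * (1 + c) - 1 : ℝ) : ℂ) * (Z + W)) * (((s ^ (m * (1 + c) - 1) : ℝ) : ℂ) *
        mittagLefflerPow m (m * (1 + c)) (s * Complex.exp (Z + W))) := by
  have hexp : Complex.exp (Real.log s + Z + W) = s * Complex.exp (Z + W) := by
    rw [add_assoc, Complex.exp_add, ← Complex.ofReal_exp, Real.exp_log hs]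
  rw [FML, hexp, mittagLeffler_pow, add_assoc, mul_add,
    Complex.exp_add, Real.rpow_def_of_pos hs, Complex.ofReal_exp, Complex.ofReal_mul,
    mul_comm (Real.log s : ℂ)]
  ring

theorem continuous_mul_mittagLefflerPow (hm : m ≠ 0) (hb : 0 < b) (hψ : Continuous ψ) (y : ℂ) :
    Continuous fun s : ℝ => ψ s * mittagLefflerPow m b (s * y) :=
  hψ.mul ((continuous_mittagLefflerPow hm hb).comp (by fun_prop))

theorem intervalIntegrable_mul_FML (hm : m ≠ 0) (hc : -1 < c) (hψ : Continuous ψ) (Z W : ℂ) :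
    IntervalIntegrable (fun s : ℝ => ψ s * FML m c (Real.log s + Z + W)) volume 0 1 := by
  have hb := natCast_mul_one_add_pos hm hc
  refine ((intervalIntegrable_rpow_mul (continuous_mul_mittagLefflerPow hm hb hψ
    (Complex.exp (Z + W))) (by linarith : -1 < m * (1 + c) - 1)).const_mul
      (Complex.exp (((m * (1 + c) - 1 : ℝ) : ℂ) * (Z + W)))).congr fun s hs => ?_
  rw [Set.uIoc_of_le zero_le_one] at hs
  simp only [FML_log_add m c Z W hs.1]
  ring

theorem integral_mul_FML (m : ℕ) (c : ℝ) (ψ : ℝ → ℂ) (Z W : ℂ) :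
    ∫ s in (0 : ℝ)..1, ψ s * FML m c (Real.log s + Z + W) =
      Complex.exp (((m * (1 + c) - 1 : ℝ) : ℂ) * (Z + W)) *
        powerMoment (fun s => ψ s * mittagLefflerPow m (m * (1 + c)) (s * Complex.exp (Z + W)))
          (m * (1 + c) - 1) := by
  rw [powerMoment, ← intervalIntegral.integral_const_mul]
  refine intervalIntegral.integral_congr_ae (ae_of_all _ fun s hs => ?_)
  rw [Set.uIoc_of_le zero_le_one] at hs
  rw [FML_log_add m c Z W hs.1]
  ring

theorem norm_rpow_add_mul_le {s : ℝ} (hs₀ : 0 < s) (hs₁ : s ≤ 1) (a : ℝ) {t : ℝ} (ht : 0 ≤ t)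
    (z : ℂ) : ‖((s ^ (a + t) : ℝ) : ℂ) * z‖ ≤ ‖((s ^ a : ℝ) : ℂ) * z‖ := by
  simp only [norm_mul, Complex.norm_real, Real.norm_of_nonneg (Real.rpow_nonneg hs₀.le _)]
  exact mul_le_mul_of_nonneg_right
    (Real.rpow_le_rpow_of_exponent_ge hs₀ hs₁ (le_add_of_nonneg_right ht)) (norm_nonneg z)

theorem hasSum_powerMoment_mul_mittagLefflerPow (hm : m ≠ 0) (hb : 0 < b) (hψ : Continuous ψ)
    (y : ℂ) :
    HasSum (fun l => invGammaCoeff m b l * y ^ (2 * m * l) *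
        powerMoment ψ (b - 1 + (2 * m * l : ℕ)))
      (powerMoment (fun s => ψ s * mittagLefflerPow m b (s * y)) (b - 1)) := by
  have hnonneg (l : ℕ) : (0 : ℝ) ≤ (2 * m * l : ℕ) := Nat.cast_nonneg _
  simp only [powerMoment, ← intervalIntegral.integral_const_mul]
  refine intervalIntegral.hasSum_integral_of_dominated_convergence
    (fun l s => ‖invGammaCoeff m b l * y ^ (2 * m * l)‖ * ‖((s ^ (b - 1) : ℝ) : ℂ) * ψ s‖)
    (fun l => ?_) (fun l => ?_) ?_ ?_ ?_
  · exact (intervalIntegrable_iff.mp ((intervalIntegrable_rpow_mul hψ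
      (by linarith [hnonneg l])).const_mul _)).1
  · refine ae_of_all _ fun s hs => ?_
    rw [Set.uIoc_of_le zero_le_one] at hs
    rw [norm_mul]
    gcongr
    exact norm_rpow_add_mul_le hs.1 hs.2 _ (hnonneg l) _
  · exact ae_of_all _ fun s _ => (hasSum_mittagLefflerPow hm hb y).summable.norm.mul_right _
  · simp only [tsum_mul_right]
    exact (intervalIntegrable_rpow_mul hψ (by linarith)).norm.const_mul _
  · refine ae_of_all _ fun s hs => ?_
    rw [Set.uIoc_of_le zero_le_one] at hs
    rw [← mul_assoc]
    refine ((hasSum_mittagLefflerPow hm hb (s * y)).mul_left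
      (((s ^ (b - 1) : ℝ) : ℂ) * ψ s)).congr_fun fun l => ?_
    rw [Real.rpow_add_natCast hs.1.ne', mul_pow]
    push_cast
    ring

theorem HasGammaMoments.powerMoment_mul_mittagLefflerPow {x : ℂ} (hψ : HasGammaMoments m x ψ)
    (hm : m ≠ 0) (hb : 0 < b) (y : ℂ) :
    powerMoment (fun s => ψ s * mittagLefflerPow m b (s * (x * y))) (b - 1) =
      halfKernelSeries m b (x ^ m, y ^ m) := by
  have hseries := ((isEntireSeries_seriesCoeff hm hb).summable_mul_pow_mul_pow
    (x ^ m) (y ^ m)).hasSum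
  refine (hasSum_powerMoment_mul_mittagLefflerPow hm hb hψ.continuous (x * y)).unique
    (hseries.prod_fiberwise fun l => ?_)
  have hmoment := hψ.hasSum_powerMoment hm (by positivity : 0 < b + 2 * m * l)
  rw [show b + 2 * m * l - 1 = b - 1 + (2 * m * l : ℕ) by push_cast; ring] at hmoment
  convert! hmoment.mul_left (invGammaCoeff m b l * (x * y) ^ (2 * m * l)) using 1
  ext p
  rw [seriesCoeff, invGammaCoeff]
  push_cast
  ring

theorem HasGammaMoments.integral_sub_mul_FML {Z W : ℂ}
    (hψ : HasGammaMoments m (Complex.exp Z) ψ) (hφ : HasGammaMoments m (Complex.exp W) φ)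
    (hm : m ≠ 0) (hc : -1 < c) :
    ∫ s in (0 : ℝ)..1, (ψ s - φ s) * FML m c (Real.log s + Z + W) =
      Complex.exp (((m * (1 + c) - 1 : ℝ) : ℂ) * (Z + W)) *
        (halfKernelSeries m (m * (1 + c)) (Complex.exp Z ^ m, Complex.exp W ^ m) -
          halfKernelSeries m (m * (1 + c)) (Complex.exp W ^ m, Complex.exp Z ^ m)) := by
  have hb := natCast_mul_one_add_pos hm hc
  simp only [sub_mul]
  rw [intervalIntegral.integral_sub (intervalIntegrable_mul_FML hm hc hψ.continuous Z W)
      (intervalIntegrable_mul_FML hm hc hφ.continuous Z W),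
    integral_mul_FML, integral_mul_FML, Complex.exp_add Z W,
    hψ.powerMoment_mul_mittagLefflerPow hm hb, mul_comm (Complex.exp Z),
    hφ.powerMoment_mul_mittagLefflerPow hm hb, mul_sub]

end MittagLefflerIntegrals

section ExplicitPreKernel

/-! ### The explicit formula for the pre-kernel -/

variable {m : ℕ} {c : ℝ}

theorem intervalIntegrable_integrandOne (hc : -1 < c) (Z W : ℂ) :
    IntervalIntegrable (integrandOne c Z W) volume 0 1 :=
  intervalIntegrable_mul_FML one_ne_zero hc (by fun_prop) Z W

theorem intervalIntegrable_integrand (hm : m ≠ 0) (hc : -1 < c) (j : ℕ) (Z W : ℂ) :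
    IntervalIntegrable (integrand m c j Z W) volume 0 1 :=
  have hW := continuous_Wminor hm j
  intervalIntegrable_mul_FML hm hc (by fun_prop) Z W

theorem kappaTilde_one (c : ℝ) (Z W : ℂ) :
    kappaTilde 1 c Z W = ∫ s in (0 : ℝ)..1,
      (Complex.exp Z * Complex.exp (1 / 2 * (Complex.exp Z ^ 2 - (s * Complex.exp Z) ^ 2)) -
        Complex.exp W * Complex.exp (1 / 2 * (Complex.exp W ^ 2 - (s * Complex.exp W) ^ 2))) *
        FML 1 c (Real.log s + Z + W) := by
  have hexponent (s : ℝ) (x : ℂ) : 1 / 2 * (1 - (s : ℂ) ^ 2) * x ^ 2 =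
      1 / 2 * (x ^ 2 - (s * x) ^ 2) := by
    ring
  simp only [kappaTilde, if_true, integrandOne, hexponent]

theorem kappaTilde_add_one {n : ℕ} (hn : n ≠ 0) (hc : -1 < c) (Z W : ℂ) :
    kappaTilde (n + 1) c Z W = ∫ s in (0 : ℝ)..1,
      (Complex.exp Z * adjointSolution n (Complex.exp Z) (Fin.last n) (s * Complex.exp Z) -
        Complex.exp W * adjointSolution n (Complex.exp W) (Fin.last n) (s * Complex.exp W)) *
        FML (n + 1 : ℕ) c (Real.log s + Z + W) := by
  rw [kappaTilde, if_neg (by simpa using hn)]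
  simp only [← intervalIntegral.integral_const_mul]
  rw [← intervalIntegral.integral_finsetSum fun j _ =>
    (intervalIntegrable_integrand n.succ_ne_zero hc j Z W).const_mul _]
  refine intervalIntegral.integral_congr fun s _ => ?_
  simp only [← sum_g_mul_Wminor, Finset.mul_sum, ← Finset.sum_sub_distrib, Finset.sum_mul]
  refine Finset.sum_congr rfl fun j _ => ?_
  rw [integrand]
  ring

theorem kappaTilde_eq (hm : m ≠ 0) (hc : -1 < c) (Z W : ℂ) :
    kappaTilde m c Z W = Complex.exp (((m * (1 + c) - 1 : ℝ) : ℂ) * (Z + W)) *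
      (halfKernelSeries m (m * (1 + c)) (Complex.exp Z ^ m, Complex.exp W ^ m) -
        halfKernelSeries m (m * (1 + c)) (Complex.exp W ^ m, Complex.exp Z ^ m)) := by
  obtain ⟨n, rfl⟩ := Nat.exists_eq_succ_of_ne_zero hm
  rcases eq_or_ne n 0 with rfl | hn
  · rw [kappaTilde_one]
    exact (isAdjointSolution_gaussian _).hasGammaMoments.integral_sub_mul_FML
      (isAdjointSolution_gaussian _).hasGammaMoments hm hc
  · rw [kappaTilde_add_one hn hc]
    exact (isAdjointSolution_adjointSolution hn _).hasGammaMoments.integral_sub_mul_FML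
      (isAdjointSolution_adjointSolution hn _).hasGammaMoments hm hc

theorem logScale_one_div (hm : m ≠ 0) (Z : ℂ) :
    m * logScale (1 / (m : ℝ)) Z = ((m / 2 * Real.log (2 * m) : ℝ) : ℂ) + Z := by
  rw [logScale, show 2 / (1 / (m : ℝ)) = 2 * m by field_simp, Real.log_sqrt (by positivity)]
  push_cast
  field_simp

theorem exp_logScale_pow (hm : m ≠ 0) (Z : ℂ) :
    Complex.exp (logScale (1 / (m : ℝ)) Z) ^ m = scaleConst m * Complex.exp Z := by
  rw [← Complex.exp_nat_mul, logScale_one_div hm, Complex.exp_add, ← Complex.ofReal_exp,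
    scaleConst, Real.rpow_def_of_pos (by positivity), mul_comm (Real.log _)]

theorem exp_mul_logScale_add (hm : m ≠ 0) (c : ℝ) (Z W : ℂ) :
    Complex.exp (((1 / (m : ℝ) - 1 : ℝ) : ℂ) * (Z + W)) *
        Complex.exp (((m * (1 + c) - 1 : ℝ) : ℂ) *
          (logScale (1 / (m : ℝ)) Z + logScale (1 / (m : ℝ)) W)) =
      Complex.exp (c * (Z + W)) * (((2 * (m : ℝ)) ^ (m * (1 + c) - 1) : ℝ) : ℂ) := by
  rw [Real.rpow_def_of_pos (by positivity), Complex.ofReal_exp, ← Complex.exp_add,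
    ← Complex.exp_add, logScale, logScale, show 2 / (1 / (m : ℝ)) = 2 * m by field_simp,
    Real.log_sqrt (by positivity)]
  congr 1
  push_cast
  field_simp
  ring

theorem kappa_eq (hm : m ≠ 0) (hc : -1 < c) (Z W : ℂ) :
    kappa m c Z W =
      Complex.exp (c * (Z + W)) * entireKernel m c (Complex.exp Z, Complex.exp W) := by
  rw [kappa, kappaTilde_eq hm hc, exp_logScale_pow hm, exp_logScale_pow hm, ← mul_assoc,
    mul_assoc (Complex.ofReal _), exp_mul_logScale_add hm, entireKernel,
    show 2 / (1 / (m : ℝ)) = 2 * m by field_simp,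
    show 1 / (2 * (1 / (m : ℝ))) = (m : ℝ) / 2 by field_simp, ← scaleConst, Complex.ofReal_mul]
  simp only [Prod.smul_mk, Prod.swap_prod_mk, smul_eq_mul]
  ring

end ExplicitPreKernel

end MittagLefflerKernel

end

theorem mainTheorem3 (m : ℕ) (hm : 1 ≤ m) (c : ℝ) (hc : -1 < c) :
    -- skew-orthogonal polynomials exist, so that the kernels below are there
    (∀ N : ℕ, 1 ≤ N → ∃ (q : ℕ → Polynomial ℝ) (s : ℕ → ℝ),
      MittagLefflerKernel.IsSkewOrthogonal N
        (MittagLefflerKernel.potential (1 / (m : ℝ)) c N) q s) ∧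
    -- the integrals in the explicit formula converge absolutely
    (m = 1 → ∀ Z W : ℂ,
      IntervalIntegrable (MittagLefflerKernel.integrandOne c Z W) volume 0 1) ∧
    (1 < m → ∀ j ∈ Finset.Icc 1 m, ∀ Z W : ℂ,
      IntervalIntegrable (MittagLefflerKernel.integrand m c j Z W) volume 0 1) ∧
    (∀ (q : ℕ → ℕ → Polynomial ℝ) (s : ℕ → ℕ → ℝ),
      (∀ N : ℕ, 1 ≤ N → MittagLefflerKernel.IsSkewOrthogonal N
        (MittagLefflerKernel.potential (1 / (m : ℝ)) c N) (q N) (s N)) →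
      -- the rescaled kernels converge to the kernel with the explicit pre-kernel
      TendstoLocallyUniformly
        (fun (N : ℕ) (p : ℂ × ℂ) =>
          MittagLefflerKernel.finiteKernel (1 / (m : ℝ)) c N (q N) (s N) p.1 p.2)
        (fun p : ℂ × ℂ =>
          MittagLefflerKernel.limitKernel (1 / (m : ℝ)) (MittagLefflerKernel.kappa m c) p.1 p.2)
        atTop ∧
      -- the normalised pre-kernels converge on all of `ℂ × ℂ`, the origin included, and the
      -- explicit pre-kernel is `(z w) ^ c` times the limit, an entire function
      ∃ P : ℂ × ℂ → ℂ, Differentiable ℂ P ∧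
        TendstoLocallyUniformly
          (fun (N : ℕ) (p : ℂ × ℂ) =>
            ((MittagLefflerKernel.microScale (1 / (m : ℝ)) N ^ (2 * c) : ℝ) : ℂ) *
              MittagLefflerKernel.rescaledPreKernel (1 / (m : ℝ)) N (q N) (s N) p.1 p.2)
          P atTop ∧
        ∀ Z W : ℂ, MittagLefflerKernel.kappa m c Z W =
          Complex.exp ((c : ℂ) * (Z + W)) * P (Complex.exp Z, Complex.exp W)) := by
  have hm₀ : m ≠ 0 := by omega
  have hlam : 0 < 1 / (m : ℝ) := by positivity
  have hκ := MittagLefflerKernel.kappa_eq hm₀ hc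
  have hentire := MittagLefflerKernel.differentiable_entireKernel hm₀ hc
  refine ⟨fun N hN => ⟨_, _, MittagLefflerKernel.isRadial_potential.isSkewOrthogonal_skewPoly
      (MittagLefflerKernel.hasPolynomialMoments_potential hlam hc (by omega))⟩,
    fun _ => MittagLefflerKernel.intervalIntegrable_integrandOne hc,
    fun _ j _ => MittagLefflerKernel.intervalIntegrable_integrand hm₀ hc j, fun q s hqs => ?_⟩
  have hlim := MittagLefflerKernel.tendstoLocallyUniformly_rescaledPreKernel hm₀ hc hqs
  exact ⟨MittagLefflerKernel.tendstoLocallyUniformly_finiteKernel hlam hentire.continuous hlim hκ,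
    MittagLefflerKernel.entireKernel m c, hentire, hlim, hκ⟩
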